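/- **Setting.** Let $\mathcal H$ be the bosonic Fock space over $\mathbb C$ with Fock basis $(|n\rangle)_{n\ge 0}$, number operator $N|n\rangle=n|n\rangle$, $a|n\rangle=\sqrt n\,|n-1\rangle$, and let $\mathcal J_1$ be the set of states (positive semidefinite trace class operators of trace $1$). Fix $\varepsilon_0,\varepsilon,\tau>0$, a real coupling $\lambda\neq 0$ and $\beta\in\mathbb R$; put $\eta=\big(\tfrac{(\varepsilon-\varepsilon_0)\tau}{2\pi}\big)^2$, $\xi=\big(\tfrac{\lambda\tau}{\pi}\big)^2$, $p(-)=\tfrac{1}{1+e^{-\beta\varepsilon}}$, $p(+)=\tfrac{e^{-\beta\varepsilon}}{1+e^{-\beta\varepsilon}}$, $$C(N)=\cos\!\big(\pi\sqrt{\xi N+\eta}\big)+i\eta^{1/2}\frac{\sin(\pi\sqrt{\xi N+\eta})}{\sqrt{\xi N+\eta}},\qquad S(N)=\xi^{1/2}\frac{\sin(\pi\sqrt{\xi N+\eta})}{\sqrt{\xi N+\eta}},$$ and define the Kraus operators of the one-atom maser $$V_{--}=p(-)^{1/2}e^{-i\tau\varepsilon N}C(N),\quad V_{-+}=p(-)^{1/2}e^{-i\tau\varepsilon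 N}S(N+1)a,$$ $$V_{+-}=p(+)^{1/2}e^{-i\tau\varepsilon N}S(N)a^*,\quad V_{++}=p(+)^{1/2}e^{-i\tau\varepsilon N}C(N+1)^*.$$ Let $\Omega=(\{-,+\}^2)^{\mathbb N^*}$ with the cylinder $\sigma$-algebra, $W_t(\omega)=V_{\omega_t}\cdots V_{\omega_1}$, and for $\rho\in\mathcal J_1$ let $\mathbb P^\rho$ be the probability measure on $\Omega$ with $\mathbb P^\rho(\{z: z_1=\omega_1,\dots,z_t=\omega_t\})=\mathrm{Tr}\big(\rho W_t^*(\omega)W_t(\omega)\big)$ for all $t$ and $\omega$. The *non-resonant condition* says that there are no positive integers $n,k$ with $\xi n+\eta=k^2$. For $\beta>0$ let $\rho_{\rm inv}=e^{-\beta\varepsilon N}/\mathrm{Tr}(e^{-\beta\varepsilon N})$ and $$M_t(\omega)=\frac{\rho_{\rm inv}^{1/2}W_t^*(\omega)W_t(\omega)\rho_{\rm inv}^{1/2}}{\mathrm{Tr}\big(W_t^*(\omega)W_t(\omega)\rho_{\rm inv}\big)}.$$ **Proposition.** Assume the non-resonant condition and $\beta>0$. Then there is a random variable $n_\infty:\Omega\to\mathbb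 N$ such that, $\mathbb P^{\rho_{\rm inv}}$-almost surely, $M_t$ converges in trace norm as $t\to\infty$ to $$M_\infty=|n_\infty\rangle\langle n_\infty|.$$ Moreover, for every $\rho\in\mathcal J_1$, $$\mathrm d\mathbb P^{\rho}=\frac{\langle n_\infty,\rho\, n_\infty\rangle}{\langle n_\infty,\rho_{\rm inv}\, n_\infty\rangle}\,\mathrm d\mathbb P^{\rho_{\rm inv}},$$ and $\mathbb P^\rho(n_\infty=n)=\langle n,\rho\, n\rangle$ for every $n\in\mathbb N$. -/

import Mathlib

open MeasureTheory ProbabilityTheory Filter Topology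
open scoped ENNReal

/-- Kolmogorov extension over a finite alphabet: consistent weights of cylinders are realized by
a probability measure on sequences. -/
theorem exists_measure_of_cylinderWeights {α : Type*} [Fintype α] [DecidableEq α] [Nonempty α]
    [MeasurableSpace α] [DiscreteMeasurableSpace α] (q : ℕ → (ℕ → α) → ℝ≥0∞)
    (hdep : ∀ t ω ω', (∀ i < t, ω i = ω' i) → q t ω = q t ω') (hzero : ∀ ω, q 0 ω = 1)
    (hsum : ∀ t ω, ∑ a, q (t + 1) (Function.update ω t a) = q t ω) :
    ∃ P : Measure (ℕ → α), IsProbabilityMeasure P ∧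
      ∀ t ω, P {z | ∀ i < t, z i = ω i} = q t ω := by
  classical
  have hle : ∀ t ω, q t ω ≤ 1 := by
    intro t
    induction t with
    | zero => intro ω; rw [hzero]
    | succ t ih =>
      intro ω
      calc q (t + 1) ω = q (t + 1) (Function.update ω t (ω t)) := by rw [Function.update_eq_self]
        _ ≤ ∑ a, q (t + 1) (Function.update ω t a) :=
            Finset.single_le_sum (f := fun a => q (t + 1) (Function.update ω t a))
              (fun _ _ => zero_le) (Finset.mem_univ (ω t))
        _ = q t ω := hsum t ω
        _ ≤ 1 := ih ω
  have hfin : ∀ t ω, q t ω ≠ ∞ := fun t ω => ((hle t ω).trans_lt ENNReal.one_lt_top).ne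
  obtain ⟨a₀⟩ := ‹Nonempty α›
  let ext : (n : ℕ) → ((i : Finset.Iic n) → α) → ℕ → α := fun n x k =>
    if h : k + 1 ∈ Finset.Iic n then x ⟨k + 1, h⟩ else a₀
  let m : (n : ℕ) → ((i : Finset.Iic n) → α) → Measure α := fun n x =>
    if q n (ext n x) = 0 then Measure.dirac a₀ else
      ∑ a, (q (n + 1) (Function.update (ext n x) n a) / q n (ext n x)) • Measure.dirac a
  have hm : ∀ n x, IsProbabilityMeasure (m n x) := by
    intro n x
    by_cases h : q n (ext n x) = 0
    · simp only [m, h, if_true]; infer_instance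
    · refine ⟨?_⟩
      simp only [m, h, if_false, Measure.coe_finsetSum, Finset.sum_apply, Measure.smul_apply,
        measure_univ, smul_eq_mul, mul_one]
      simp_rw [div_eq_mul_inv]
      rw [← Finset.sum_mul, hsum, ENNReal.mul_inv_cancel h (hfin _ _)]
  let κ : (n : ℕ) → Kernel ((i : Finset.Iic n) → α) α := fun n =>
    ⟨m n, measurable_from_top.mono (by
      rw [show (MeasurableSpace.pi : MeasurableSpace ((i : Finset.Iic n) → α)) = ⊤ from
        MeasurableSpace.ext fun s => by simp [MeasurableSet.of_discrete]]) le_rfl⟩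
  have : ∀ n, IsMarkovKernel (κ n) := fun n => ⟨hm n⟩
  let x₀ : (i : Finset.Iic 0) → α := fun _ => a₀
  let μ : Measure (ℕ → α) := Kernel.traj (X := fun _ => α) κ 0 x₀
  have hshift : Measurable (fun (z : ℕ → α) (n : ℕ) => z (n + 1)) := by fun_prop
  have hmeas : ∀ t (ω : ℕ → α), MeasurableSet {z : ℕ → α | ∀ i < t, z i = ω i} := by
    intro t ω
    have : {z : ℕ → α | ∀ i < t, z i = ω i} = ⋂ i, ⋂ (_ : i < t), (fun z => z i) ⁻¹' {ω i} := by
      ext z; simp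
    rw [this]
    exact MeasurableSet.iInter fun i => MeasurableSet.iInter fun _ =>
      (measurable_pi_apply i) (MeasurableSet.singleton _)
  have hmeas' : ∀ t (ω : ℕ → α), MeasurableSet {z : ℕ → α | ∀ i < t, z (i + 1) = ω i} :=
    fun t ω => hshift (hmeas t ω)
  have key : ∀ t (ω : ℕ → α), μ {z : ℕ → α | ∀ i < t, z (i + 1) = ω i} = q t ω := by
    intro t
    induction t with
    | zero => intro ω; simp [hzero, μ]
    | succ t ih =>
      intro ω
      have hcond : ∀ y : (i : Finset.Iic t) → α,
          Kernel.traj (X := fun _ => α) κ t y {z : ℕ → α | ∀ i < t + 1, z (i + 1) = ω i} =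
            Set.indicator {y | ∀ i < t, ext t y i = ω i} (fun y => κ t y {ω t}) y := by
        intro y
        have h1 : ∀ᵐ z ∂(Kernel.traj (X := fun _ => α) κ t y),
            Preorder.frestrictLe (π := fun _ => α) t z = y := by
          have h2 := DFunLike.congr_fun (Kernel.traj_map_frestrictLe_of_le (X := fun _ => α) (κ := κ) (le_refl t)) y
          rw [Kernel.map_apply _ (by fun_prop), Kernel.deterministic_apply] at h2
          have h3 : ∀ᵐ w ∂((Kernel.traj (X := fun _ => α) κ t y).map
              (Preorder.frestrictLe (π := fun _ => α) t)), w = y := by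
            rw [h2, ae_dirac_iff (MeasurableSet.of_discrete)]
            rfl
          exact ae_of_ae_map (by fun_prop) h3
        have h4 := DFunLike.congr_fun (Kernel.map_traj_succ_self (X := fun _ => α) (κ := κ) (a := t)) y
        rw [Kernel.map_apply _ (by fun_prop)] at h4
        by_cases hy : ∀ i < t, ext t y i = ω i
        · rw [Set.indicator_of_mem (by exact hy), ← h4, Measure.map_apply (by fun_prop)
            (MeasurableSet.singleton _)]
          apply measure_congr
          filter_upwards [h1] with z hz
          apply propext
          constructor
          · intro h; exact h t (by omega)
          · intro h i hi
            rcases Nat.lt_succ_iff_lt_or_eq.mp hi with hi | rfl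
            · rw [← hy i hi]
              simp only [ext]
              rw [dif_pos (by simp; omega), ← hz]
              rfl
            · exact h
        · rw [Set.indicator_of_notMem (by exact hy)]
          rw [measure_eq_zero_iff_ae_notMem]
          filter_upwards [h1] with z hz h
          apply hy
          intro i hi
          rw [← h i (by omega)]
          simp only [ext]
          rw [dif_pos (by simp; omega), ← hz]
          rfl
      have hval : ∀ y : (i : Finset.Iic t) → α,
          Set.indicator {y | ∀ i < t, ext t y i = ω i} (fun y => κ t y {ω t}) y =
          Set.indicator {y | ∀ i < t, ext t y i = ω i} (fun _ => if q t ω = 0 then κ t y {ω t} else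
            q (t + 1) ω / q t ω) y := by
        intro y
        by_cases hy : ∀ i < t, ext t y i = ω i
        · rw [Set.indicator_of_mem (by exact hy), Set.indicator_of_mem (by exact hy)]
          have e1 : q t (ext t y) = q t ω := hdep _ _ _ hy
          split_ifs with h0
          · rfl
          · change m t y {ω t} = _
            simp only [m, e1, h0, if_false, Measure.coe_finsetSum, Finset.sum_apply,
              Measure.smul_apply, smul_eq_mul]
            rw [Finset.sum_eq_single (ω t)]
            · rw [Measure.dirac_apply_of_mem (by simp), mul_one]
              congr 1
              apply hdep
              intro i hi
              rcases Nat.lt_succ_iff_lt_or_eq.mp hi with hi | rfl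
              · rw [Function.update_of_ne hi.ne]; exact hy i hi
              · simp
            · intro b _ hb
              rw [Measure.dirac_apply' _ (MeasurableSet.singleton _),
                Set.indicator_of_notMem (by simpa using hb), mul_zero]
            · simp
        · rw [Set.indicator_of_notMem (by exact hy), Set.indicator_of_notMem (by exact hy)]
      have hbind : ∀ S : Set (ℕ → α), MeasurableSet S →
          μ S = ∫⁻ y, Kernel.traj (X := fun _ => α) κ t y S
            ∂(Kernel.partialTraj (X := fun _ => α) κ 0 t x₀) := by
        intro S hS
        simp only [μ]
        rw [← Kernel.traj_comp_partialTraj (X := fun _ => α) (κ := κ) (Nat.zero_le t), Kernel.comp_apply' _ _ _ hS]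
      have hpart : Kernel.partialTraj (X := fun _ => α) κ 0 t x₀
          {y | ∀ i < t, ext t y i = ω i} = q t ω := by
        rw [← ih ω, ← Kernel.traj_map_frestrictLe_apply,
          Measure.map_apply (by fun_prop) (MeasurableSet.of_discrete)]
        congr 1
        ext z
        simp only [Set.mem_preimage, Set.mem_ofPred_eq, ext]
        refine forall₂_congr fun i hi => ?_
        rw [dif_pos (by simp; omega)]
        rfl
      rw [hbind _ (hmeas' _ _)]
      simp_rw [hcond]
      by_cases h0 : q t ω = 0
      · have hq : q (t + 1) ω = 0 := by
          have := hsum t ω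
          rw [h0, Finset.sum_eq_zero_iff] at this
          have h5 := this (ω t) (Finset.mem_univ _)
          rwa [Function.update_eq_self] at h5
        rw [lintegral_indicator MeasurableSet.of_discrete, hq,
          setLIntegral_measure_zero _ _ (by rw [hpart, h0])]
      · simp_rw [hval, if_neg h0]
        rw [lintegral_indicator MeasurableSet.of_discrete, setLIntegral_const, hpart,
          ENNReal.div_mul_cancel h0 (hfin _ _)]
  refine ⟨μ.map (fun z n => z (n + 1)), ?_, ?_⟩
  · exact Measure.isProbabilityMeasure_map hshift.aemeasurable
  · intro t ω
    rw [Measure.map_apply hshift (hmeas t ω)]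
    exact key t ω

noncomputable section

namespace OneAtomMaser

section Operators

variable {H : Type*} [NormedAddCommGroup H] [InnerProductSpace ℂ H] [CompleteSpace H]

/-- The absolute value `|T| = (T⋆T)^{1/2}` of a bounded operator. -/
def opAbs (T : H →L[ℂ] H) : H →L[ℂ] H := CFC.abs T

/-- The square root of a positive bounded operator. -/
def opSqrt (T : H →L[ℂ] H) : H →L[ℂ] H := CFC.sqrt T

theorem opAbs_of_isPositive {T : H →L[ℂ] H} (hT : T.IsPositive) : opAbs T = T :=
  CFC.abs_of_nonneg _ ((ContinuousLinearMap.nonneg_iff_isPositive _).2 hT)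

end Operators

/-! ### Fock space, trace and trace norm -/

/-- The bosonic Fock space over `ℂ`, realized as `ℓ²(ℕ)`. -/
abbrev FockSpace : Type := lp (fun _ : ℕ => ℂ) 2

/-- Bounded operators on Fock space. -/
abbrev Op : Type := FockSpace →L[ℂ] FockSpace

/-- The Fock vector `|n⟩`. -/
def fock (n : ℕ) : FockSpace := lp.single 2 n (1 : ℂ)

/-- The rank-one projection `|n⟩⟨n|`. -/
def fockProj (n : ℕ) : Op := InnerProductSpace.rankOne ℂ (fock n) (fock n)

/-- The trace `∑ₙ ⟨n, T n⟩`, meaningful for trace class `T`. -/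
def trace (T : Op) : ℂ := ∑' n, inner ℂ (fock n) (T (fock n))

/-- The trace norm `‖T‖₁ = Tr |T|`, where `|T| = (T⋆T)^{1/2}`; it is `∞` iff `T` is not
trace class. -/
def traceNorm (T : Op) : ℝ≥0∞ :=
  ∑' n, ENNReal.ofReal (inner ℂ (fock n) (opAbs T (fock n))).re

/-- States (density operators): positive semidefinite trace class operators with unit trace. -/
structure State where
  op : Op
  isPositive : op.IsPositive
  traceClass : traceNorm op ≠ ∞
  trace_eq_one : trace op = 1

/-- The population `⟨n, ρ n⟩` (a nonnegative real number). -/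
def State.population (ρ : State) (n : ℕ) : ℝ := (inner ℂ (fock n) (ρ.op (fock n))).re

/-- The operator `f(N)`, for a bounded function `f` of the number operator:
`f(N)|n⟩ = f(n)|n⟩`. -/
def numberFn (f : ℕ → ℂ) (hf : ∃ K, ∀ n, ‖f n‖ ≤ K) : Op :=
  lp.mapCLM 2 (fun n => f n • ContinuousLinearMap.id ℂ ℂ)
    ((norm_nonneg _).trans (hf.choose_spec 0)) (fun n => by
      have := hf.choose_spec n
      rw [norm_smul]
      simpa using this)

theorem memlp_shift (x : FockSpace) : Memℓp (fun n => x (n + 1)) 2 := by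
  have h := lp.memℓp x
  rw [memℓp_gen_iff (by norm_num)] at h ⊢
  exact h.comp_injective (add_left_injective 1)

/-- The lowering shift `|n+1⟩ ↦ |n⟩`, `|0⟩ ↦ 0`. The annihilation operator `a` is
`√(N+1)` composed with it. -/
def lower : Op :=
  LinearMap.mkContinuous
    { toFun := fun x => ⟨fun n => x (n + 1), memlp_shift x⟩
      map_add' := fun _ _ => rfl
      map_smul' := fun _ _ => rfl } 1 (fun x => by
        have h1 := lp.norm_rpow_eq_tsum (p := 2) (by norm_num) x
        have h2 := lp.norm_rpow_eq_tsum (p := 2) (by norm_num)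
          (⟨fun n => x (n + 1), memlp_shift x⟩ : FockSpace)
        have h : Summable fun n => ‖x n‖ ^ (2 : ℝ≥0∞).toReal :=
          (memℓp_gen_iff (by norm_num)).1 (lp.memℓp x)
        have h3 := tsum_comp_le_tsum_of_inj h
          (fun _ => by positivity) (add_left_injective 1)
        rw [one_mul, ← Real.rpow_le_rpow_iff (norm_nonneg _) (norm_nonneg _)
          (show 0 < (2 : ℝ≥0∞).toReal by norm_num), h1]
        exact h2.trans_le h3)

/-- The raising shift `|n⟩ ↦ |n+1⟩`, adjoint of `lower`. The creation operator `a⋆` is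
`√N` composed with it. -/
def raise : Op := star lower

theorem numberFn_apply (f : ℕ → ℂ) (hf) (x : FockSpace) (n : ℕ) :
    numberFn f hf x n = f n * x n := by
  simp [numberFn]

theorem lower_apply (x : FockSpace) (n : ℕ) : lower x n = x (n + 1) := rfl

theorem inner_fock (n : ℕ) (x : FockSpace) : inner ℂ (fock n) x = x n := by
  rw [fock, lp.inner_single_left]; simp

theorem fock_apply (m n : ℕ) : fock m n = if n = m then 1 else 0 := by
  rw [fock, lp.single_apply]
  simp [Pi.single_apply]

theorem star_apply_coord (T : Op) (x : FockSpace) (n : ℕ) :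
    (star T) x n = inner ℂ (T (fock n)) x := by
  rw [← inner_fock, ContinuousLinearMap.star_eq_adjoint, ContinuousLinearMap.adjoint_inner_right]

theorem numberFn_fock (f : ℕ → ℂ) (hf) (n : ℕ) : numberFn f hf (fock n) = f n • fock n := by
  ext m
  rw [numberFn_apply, lp.coeFn_smul, Pi.smul_apply, fock_apply]
  split_ifs with h
  · rw [h]; simp
  · simp

theorem star_numberFn_apply (f : ℕ → ℂ) (hf) (x : FockSpace) (n : ℕ) :
    (star (numberFn f hf)) x n = starRingEnd ℂ (f n) * x n := by
  rw [star_apply_coord, numberFn_fock, inner_smul_left, inner_fock]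

theorem lower_fock_zero : lower (fock 0) = 0 := by
  ext m; rw [lower_apply, fock_apply]; simp

theorem lower_fock_succ (n : ℕ) : lower (fock (n + 1)) = fock n := by
  ext m; rw [lower_apply, fock_apply, fock_apply]; simp

theorem raise_apply_zero (x : FockSpace) : raise x 0 = 0 := by
  rw [raise, star_apply_coord, lower_fock_zero, inner_zero_left]

theorem raise_apply_succ (x : FockSpace) (n : ℕ) : raise x (n + 1) = x n := by
  rw [raise, star_apply_coord, lower_fock_succ, inner_fock]

theorem raise_fock (n : ℕ) : raise (fock n) = fock (n + 1) := by
  ext m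
  cases m with
  | zero => rw [raise_apply_zero, fock_apply]; simp
  | succ m => rw [raise_apply_succ, fock_apply, fock_apply]; simp

/-! ### The model -/

/-- The physical parameters of the one-atom maser. -/
structure Maser where
  /-- frequency of the cavity mode -/
  ε₀ : ℝ
  /-- Bohr frequency of the atoms -/
  ε : ℝ
  /-- atom-field coupling constant -/
  lam : ℝ
  /-- duration of one atom-field interaction -/
  τ : ℝ
  /-- inverse temperature of the atoms -/
  β : ℝ
  ε₀_pos : 0 < ε₀
  ε_pos : 0 < ε
  lam_ne_zero : lam ≠ 0
  τ_pos : 0 < τ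

/-- Outcome `(σ, σ')` of the double measurement on one atom, before and after the interaction;
`false` is the ground state `-` and `true` the excited state `+`. -/
abbrev Outcome : Type := Bool × Bool

/-- The space `Ω` of outcome sequences, with the product (cylinder) σ-algebra;
`ω t` is the outcome of the `(t+1)`-st measurement. -/
abbrev Trajectory : Type := ℕ → Outcome

namespace Maser

variable (M : Maser)

/-- The detuning parameter `η = (Δτ/2π)²`, `Δ = ε - ε₀`. -/
def η : ℝ := ((M.ε - M.ε₀) * M.τ / (2 * Real.pi)) ^ 2

/-- The dimensionless coupling constant `ξ = (λτ/π)²`. -/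
def ξ : ℝ := (M.lam * M.τ / Real.pi) ^ 2

/-- There is no Rabi resonance: no positive integers `n`, `k` satisfy `ξn + η = k²`. -/
def NonResonant : Prop := ∀ n k : ℕ, 0 < n → 0 < k → M.ξ * n + M.η ≠ (k : ℝ) ^ 2

/-- The probability that an atom enters in its ground (`false`) or excited (`true`) state. -/
def pAt : Bool → ℝ
  | false => 1 / (1 + Real.exp (-M.β * M.ε))
  | true => Real.exp (-M.β * M.ε) / (1 + Real.exp (-M.β * M.ε))

/-- `C(n) = cos(π√(ξn+η)) + i η^{1/2} sin(π√(ξn+η))/√(ξn+η)`. For `ξn+η = 0` (i.e. `η = n = 0`)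
the quotient has coefficient zero. -/
def C (n : ℕ) : ℂ :=
  (Real.cos (Real.pi * √(M.ξ * n + M.η)) : ℂ) +
    Complex.I * ((√M.η * (Real.sin (Real.pi * √(M.ξ * n + M.η)) / √(M.ξ * n + M.η)) : ℝ) : ℂ)

/-- `S(n) = ξ^{1/2} sin(π√(ξn+η))/√(ξn+η)`; only the values at `n ≥ 1`, where `ξn+η > 0`, enter
the Kraus operators. -/
def S (n : ℕ) : ℝ :=
  √M.ξ * (Real.sin (Real.pi * √(M.ξ * n + M.η)) / √(M.ξ * n + M.η))

/-- `e^{-iτεn}`. -/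
def phase (n : ℕ) : ℂ := Complex.exp (-Complex.I * (M.τ * M.ε * n : ℝ))

theorem ξ_pos : 0 < M.ξ := by
  have := M.lam_ne_zero
  have := M.τ_pos.ne'
  have := Real.pi_ne_zero
  unfold ξ
  positivity

theorem η_nonneg : 0 ≤ M.η := sq_nonneg _

theorem normSq_C_add (n : ℕ) : Complex.normSq (M.C n) + M.S n ^ 2 * n = 1 := by
  have hη := M.η_nonneg
  have hξ := M.ξ_pos
  have hx : 0 ≤ M.ξ * n + M.η := by positivity
  have hC : Complex.normSq (M.C n) = Real.cos (Real.pi * √(M.ξ * n + M.η)) ^ 2 +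
      (√M.η * (Real.sin (Real.pi * √(M.ξ * n + M.η)) / √(M.ξ * n + M.η))) ^ 2 := by
    rw [C, mul_comm Complex.I, Complex.normSq_add_mul_I]
  rw [hC, S, mul_pow, mul_pow, Real.sq_sqrt hη, Real.sq_sqrt hξ.le]
  rcases hx.eq_or_lt with h | h
  · rw [← h]; simp
  · rw [div_pow, Real.sq_sqrt hx]
    have := Real.sin_sq_add_cos_sq (Real.pi * √(M.ξ * n + M.η))
    field_simp
    linear_combination (M.ξ * n + M.η) * this

theorem norm_C_le (n : ℕ) : ‖M.C n‖ ≤ 1 := by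
  have h := M.normSq_C_add n
  rw [Complex.normSq_eq_norm_sq] at h
  have : 0 ≤ M.S n ^ 2 * n := by positivity
  exact (sq_le_one_iff₀ (norm_nonneg _)).1 (by linarith)

theorem norm_S_sqrt_le (n : ℕ) : ‖((M.S n * √n : ℝ) : ℂ)‖ ≤ 1 := by
  have h := M.normSq_C_add n
  have h2 := Complex.normSq_nonneg (M.C n)
  rw [Complex.norm_real, ← sq_le_one_iff₀ (norm_nonneg _), Real.norm_eq_abs, sq_abs, mul_pow,
    Real.sq_sqrt (Nat.cast_nonneg n)]
  linarith

theorem norm_phase (n : ℕ) : ‖M.phase n‖ = 1 := by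
  rw [phase, Complex.norm_exp]; simp

/-- The Kraus operators `V_{σσ'}`:
`V₋₋ = p(-)^{1/2} e^{-iτεN} C(N)`, `V₋₊ = p(-)^{1/2} e^{-iτεN} S(N+1) a`,
`V₊₋ = p(+)^{1/2} e^{-iτεN} S(N) a⋆`, `V₊₊ = p(+)^{1/2} e^{-iτεN} C(N+1)⋆`,
where `S(N+1) a` and `S(N) a⋆` are the bounded operators `(S(N+1) √(N+1)) ∘ lower` and
`(S(N) √N) ∘ raise`. -/
def kraus : Outcome → Op
  | (false, false) => ((√(M.pAt false) : ℝ) : ℂ) •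
      (numberFn M.phase ⟨1, fun n => (M.norm_phase n).le⟩ * numberFn M.C ⟨1, M.norm_C_le⟩)
  | (false, true) => ((√(M.pAt false) : ℝ) : ℂ) •
      (numberFn M.phase ⟨1, fun n => (M.norm_phase n).le⟩ *
        (numberFn (fun n => ((M.S (n + 1) * √((n + 1 : ℕ) : ℝ) : ℝ) : ℂ))
          ⟨1, fun n => M.norm_S_sqrt_le (n + 1)⟩ * lower))
  | (true, false) => ((√(M.pAt true) : ℝ) : ℂ) •
      (numberFn M.phase ⟨1, fun n => (M.norm_phase n).le⟩ *
        (numberFn (fun n => ((M.S n * √(n : ℝ) : ℝ) : ℂ)) ⟨1, M.norm_S_sqrt_le⟩ * raise))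
  | (true, true) => ((√(M.pAt true) : ℝ) : ℂ) •
      (numberFn M.phase ⟨1, fun n => (M.norm_phase n).le⟩ *
        star (numberFn (fun n => M.C (n + 1)) ⟨1, fun n => M.norm_C_le (n + 1)⟩))

/-- `W_t(ω) = V_{ω_t} ⋯ V_{ω_1}`, with `W_0 = 1`. -/
def W : ℕ → Trajectory → Op
  | 0, _ => 1
  | t + 1, ω => M.kraus (ω t) * W t ω

theorem pAt_nonneg (σ : Bool) : 0 ≤ M.pAt σ := by
  cases σ <;> simp only [pAt] <;> positivity

theorem pAt_add : M.pAt false + M.pAt true = 1 := by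
  simp only [pAt]
  have := Real.exp_pos (-M.β * M.ε)
  field_simp

/-- Diagonal operators in the Fock basis. -/
def IsDiag (T : Op) (f : ℕ → ℂ) : Prop := ∀ x n, T x n = f n * x n

theorem phase_conj_mul (n : ℕ) : starRingEnd ℂ (M.phase n) * M.phase n = 1 := by
  rw [← Complex.normSq_eq_conj_mul_self, Complex.normSq_eq_norm_sq, norm_phase]; simp

theorem sqrt_pAt_mul (σ : Bool) :
    ((√(M.pAt σ) : ℝ) : ℂ) * ((√(M.pAt σ) : ℝ) : ℂ) = (M.pAt σ : ℂ) := by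
  rw [← Complex.ofReal_mul, Real.mul_self_sqrt (M.pAt_nonneg σ)]

theorem conj_C_mul (n : ℕ) : starRingEnd ℂ (M.C n) * M.C n =
    ((1 - M.S n ^ 2 * n : ℝ) : ℂ) := by
  rw [← Complex.normSq_eq_conj_mul_self]
  congr 1
  linarith [M.normSq_C_add n]

/-- How the Kraus operators transform diagonal operators. -/
def krausDiag (f : ℕ → ℂ) : Outcome → ℕ → ℂ
  | (false, false), n => ((M.pAt false * (1 - M.S n ^ 2 * n) : ℝ) : ℂ) * f n
  | (false, true), n => ((M.pAt false * (M.S n ^ 2 * n) : ℝ) : ℂ) * f (n - 1)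
  | (true, false), n => ((M.pAt true * (M.S (n + 1) ^ 2 * (n + 1 : ℕ)) : ℝ) : ℂ) * f (n + 1)
  | (true, true), n => ((M.pAt true * (1 - M.S (n + 1) ^ 2 * (n + 1 : ℕ)) : ℝ) : ℂ) * f n

theorem isDiag_kraus {T : Op} {f : ℕ → ℂ} (hT : IsDiag T f) (y : Outcome) :
    IsDiag (star (M.kraus y) * T * M.kraus y) (M.krausDiag f y) := by
  have hS : ∀ n : ℕ, ((√(n : ℝ) : ℝ) : ℂ) * ((√(n : ℝ) : ℝ) : ℂ) = n := by
    intro n; rw [← Complex.ofReal_mul, Real.mul_self_sqrt (Nat.cast_nonneg n)]; simp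
  intro x n
  obtain ⟨σ, σ'⟩ := y
  cases σ <;> cases σ'
  · simp only [kraus, star_smul, star_mul, mul_assoc, mul_apply_eq_comp,
      smul_apply, lp.coeFn_smul, Pi.smul_apply, star_numberFn_apply,
      numberFn_apply, hT _ _, smul_eq_mul, krausDiag, Complex.star_def, Complex.conj_ofReal]
    push_cast
    have h1 := M.phase_conj_mul n
    have h2 := M.sqrt_pAt_mul false
    have h3 := M.conj_C_mul n
    push_cast at h3
    rw [← h2, ← h3]
    linear_combination ((√(M.pAt false) : ℝ) : ℂ) * ((√(M.pAt false) : ℝ) : ℂ) *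
      starRingEnd ℂ (M.C n) * M.C n * f n * x n * h1
  · cases n with
    | zero =>
      simp only [kraus, star_smul, star_mul, mul_assoc, mul_apply_eq_comp,
        smul_apply, lp.coeFn_smul, Pi.smul_apply, krausDiag]
      rw [← raise, raise_apply_zero]
      simp
    | succ n =>
      simp only [kraus, star_smul, star_mul, mul_assoc, mul_apply_eq_comp,
        smul_apply, lp.coeFn_smul, Pi.smul_apply, krausDiag]
      rw [← raise, raise_apply_succ]
      simp only [star_numberFn_apply, numberFn_apply, hT _ _, smul_eq_mul, lower_apply,
        Complex.star_def, Complex.conj_ofReal, lp.coeFn_smul, Pi.smul_apply, Nat.add_sub_cancel]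
      push_cast
      have h1 := M.phase_conj_mul n
      have h2 := M.sqrt_pAt_mul false
      have h3 := hS (n + 1)
      push_cast at h3
      rw [← h2, ← h3]
      linear_combination ((√(M.pAt false) : ℝ) : ℂ) * ((√(M.pAt false) : ℝ) : ℂ) *
        (M.S (n + 1) : ℂ) ^ 2 * (((√((n : ℝ) + 1) : ℝ) : ℂ) * ((√((n : ℝ) + 1) : ℝ) : ℂ)) *
        f n * x (n + 1) * h1
  · simp only [kraus, star_smul, star_mul, mul_assoc, mul_apply_eq_comp,
      smul_apply, lp.coeFn_smul, Pi.smul_apply, krausDiag]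
    rw [show star raise = lower by rw [raise, star_star], lower_apply]
    simp only [star_numberFn_apply, numberFn_apply, hT _ _, smul_eq_mul, raise_apply_succ,
        Complex.star_def, Complex.conj_ofReal, lp.coeFn_smul, Pi.smul_apply]
    push_cast
    have h1 := M.phase_conj_mul (n + 1)
    have h2 := M.sqrt_pAt_mul true
    have h3 := hS (n + 1)
    push_cast at h3
    rw [← h2, ← h3]
    linear_combination ((√(M.pAt true) : ℝ) : ℂ) * ((√(M.pAt true) : ℝ) : ℂ) *
        (M.S (n + 1) : ℂ) ^ 2 * (((√((n : ℝ) + 1) : ℝ) : ℂ) * ((√((n : ℝ) + 1) : ℝ) : ℂ)) *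
        f (n + 1) * x n * h1
  · simp only [kraus, star_smul, star_mul, mul_assoc, mul_apply_eq_comp, star_star,
      smul_apply, lp.coeFn_smul, Pi.smul_apply, star_numberFn_apply,
      numberFn_apply, hT _ _, smul_eq_mul, krausDiag, Complex.star_def, Complex.conj_ofReal]
    push_cast
    have h1 := M.phase_conj_mul n
    have h2 := M.sqrt_pAt_mul true
    have h3 := M.conj_C_mul (n + 1)
    push_cast at h3
    rw [← h2, ← h3]
    linear_combination ((√(M.pAt true) : ℝ) : ℂ) * ((√(M.pAt true) : ℝ) : ℂ) *
      starRingEnd ℂ (M.C (n + 1)) * M.C (n + 1) * f n * x n * h1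

/-- The Kraus identity `∑ V⋆V = 1`. -/
theorem sum_kraus : ∑ y, star (M.kraus y) * M.kraus y = 1 := by
  have h1 : IsDiag (1 : Op) (fun _ => 1) := fun x n => by simp
  have h : ∀ y, IsDiag (star (M.kraus y) * M.kraus y) (M.krausDiag (fun _ => 1) y) := by
    intro y; simpa using M.isDiag_kraus h1 y
  have hp : (M.pAt false : ℂ) + M.pAt true = 1 := by exact_mod_cast M.pAt_add
  ext x n
  rw [Fintype.sum_prod_type]
  simp only [Fintype.sum_bool, add_apply, lp.coeFn_add, Pi.add_apply, h _ _ _,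
    krausDiag, one_apply_eq_self]
  push_cast
  linear_combination x n * hp

theorem exists_isDiag_W (t : ℕ) (ω : Trajectory) {T : Op} {f : ℕ → ℂ} (hT : IsDiag T f) :
    ∃ g, IsDiag (star (M.W t ω) * T * M.W t ω) g := by
  induction t generalizing T f with
  | zero => exact ⟨f, by simpa [W] using hT⟩
  | succ t ih =>
    obtain ⟨g, hg⟩ := ih (M.isDiag_kraus hT (ω t))
    exact ⟨g, by simpa [W, mul_assoc] using hg⟩

theorem W_congr {t : ℕ} {ω ω' : Trajectory} (h : ∀ i < t, ω i = ω' i) : M.W t ω = M.W t ω' := by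
  induction t with
  | zero => rfl
  | succ t ih =>
    rw [W, W, h t (Nat.lt_succ_self t), ih fun i hi => h i (by omega)]

end Maser

theorem State.population_nonneg (ρ : State) (n : ℕ) : 0 ≤ ρ.population n :=
  ρ.isPositive.re_inner_nonneg_right (fock n)

theorem State.ofReal_population (ρ : State) (n : ℕ) :
    (inner ℂ (fock n) (ρ.op (fock n)) : ℂ) = (ρ.population n : ℂ) := by
  have h := ρ.isPositive.inner_nonneg_right (fock n)
  rw [Complex.nonneg_iff] at h
  exact Complex.ext rfl (by simpa using h.2.symm)

theorem State.hasSum_population (ρ : State) : HasSum ρ.population 1 := by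
  have hnn := ρ.population_nonneg
  have h1 := ρ.traceClass
  rw [traceNorm, opAbs_of_isPositive ρ.isPositive] at h1
  have h2 : Summable ρ.population := by
    have := ENNReal.summable_toReal h1
    refine this.congr fun n => ?_
    exact ENNReal.toReal_ofReal (hnn n)
  have h3 := ρ.ofReal_population
  have h4 := ρ.trace_eq_one
  rw [trace, tsum_congr h3, ← Complex.ofReal_tsum] at h4
  have h5 : ∑' n, ρ.population n = 1 := by exact_mod_cast h4
  exact h5 ▸ h2.hasSum

namespace Maser

variable (M : Maser)

/-- The probability `Tr(ρ W_t⋆ W_t)` of the first `t` outcomes of `ω` in the initial state `ρ`. -/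
def weight (ρ : State) (t : ℕ) (ω : Trajectory) : ℝ≥0∞ :=
  ENNReal.ofReal (trace (ρ.op * (star (M.W t ω) * M.W t ω))).re

theorem hasSum_trace_mul (ρ : State) {A : Op} {f : ℕ → ℂ} (hA : IsDiag A f) :
    HasSum (fun n => ρ.population n * (f n).re) (trace (ρ.op * A)).re := by
  have hfock : ∀ n, A (fock n) = f n • fock n := by
    intro n
    ext m
    rw [hA, lp.coeFn_smul, Pi.smul_apply, fock_apply]
    split_ifs with h
    · rw [h]; simp
    · simp
  have hb : ∀ n, ‖f n‖ ≤ ‖A‖ := by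
    intro n
    have h1 : f n = A (fock n) n := by rw [hA, fock_apply]; simp
    have h2 : ‖fock n‖ = 1 := by rw [fock, lp.norm_single (by norm_num)]; simp
    calc ‖f n‖ = ‖A (fock n) n‖ := by rw [h1]
      _ ≤ ‖A (fock n)‖ := lp.norm_apply_le_norm (by norm_num) _ _
      _ ≤ ‖A‖ * ‖fock n‖ := A.le_opNorm _
      _ = ‖A‖ := by rw [h2, mul_one]
  have hterm : ∀ n, (inner ℂ (fock n) ((ρ.op * A) (fock n)) : ℂ) = ρ.population n * f n := by
    intro n
    rw [mul_apply_eq_comp, hfock, map_smul, inner_smul_right, ρ.ofReal_population, mul_comm]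
  have hs : Summable fun n => (ρ.population n : ℂ) * f n := by
    refine Summable.of_norm_bounded (ρ.hasSum_population.summable.mul_right ‖A‖) fun n => ?_
    rw [norm_mul, Complex.norm_real, Real.norm_of_nonneg (ρ.population_nonneg n)]
    exact mul_le_mul_of_nonneg_left (hb n) (ρ.population_nonneg n)
  rw [trace, tsum_congr hterm]
  simpa using Complex.hasSum_re hs.hasSum

theorem exists_law (ρ : State) : ∃ P : Measure Trajectory, IsProbabilityMeasure P ∧
    ∀ t ω, P {z | ∀ i < t, z i = ω i} = M.weight ρ t ω := by
  have h1 : IsDiag (1 : Op) (fun _ => 1) := fun x n => by simp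
  refine exists_measure_of_cylinderWeights _ ?_ ?_ ?_
  · intro t ω ω' h
    rw [weight, weight, M.W_congr h]
  · intro ω
    rw [weight, W, star_one, mul_one, mul_one, ρ.trace_eq_one]
    simp
  · intro t ω
    have hW : ∀ a, M.W (t + 1) (Function.update ω t a) = M.kraus a * M.W t ω := by
      intro a
      rw [W, Function.update_self, M.W_congr (ω' := ω)]
      intro i hi
      rw [Function.update_of_ne hi.ne]
    have hD : ∀ a, ∃ g, IsDiag (star (M.kraus a * M.W t ω) * (M.kraus a * M.W t ω)) g := by
      intro a
      obtain ⟨g, hg⟩ := M.exists_isDiag_W t ω (M.isDiag_kraus h1 a)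
      exact ⟨g, by simpa [mul_assoc] using hg⟩
    choose g hg using hD
    have hg0 : ∀ a n, 0 ≤ (g a n).re := by
      intro a n
      have e1 : g a n = (star (M.kraus a * M.W t ω) * (M.kraus a * M.W t ω)) (fock n) n := by
        rw [hg, fock_apply]; simp
      rw [e1, mul_apply_eq_comp, star_apply_coord]
      exact inner_self_nonneg (𝕜 := ℂ)
    have hsum : IsDiag (star (M.W t ω) * M.W t ω) (fun n => ∑ a, g a n) := by
      intro x n
      have e2 : star (M.W t ω) * M.W t ω =
          ∑ a, star (M.kraus a * M.W t ω) * (M.kraus a * M.W t ω) := by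
        have : ∀ a, star (M.kraus a * M.W t ω) * (M.kraus a * M.W t ω) =
            star (M.W t ω) * (star (M.kraus a) * M.kraus a) * M.W t ω := by
          intro a; rw [star_mul]; simp only [mul_assoc]
        simp_rw [this]
        rw [← Finset.sum_mul, ← Finset.mul_sum, M.sum_kraus, mul_one]
      rw [e2, Finset.sum_mul]
      simp only [Fintype.sum_prod_type, Fintype.sum_bool, add_apply, lp.coeFn_add, Pi.add_apply,
        hg _ _ _]
    have hS := fun a => hasSum_trace_mul ρ (hg a)
    have hT := hasSum_trace_mul ρ hsum
    have hadd := hasSum_sum (s := Finset.univ) (fun a _ => hS a)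
    simp only [weight, hW]
    rw [← ENNReal.ofReal_sum_of_nonneg]
    · congr 1
      refine hadd.unique ?_
      convert hT using 2 with n
      rw [Complex.re_sum, Finset.mul_sum]
    · intro a _
      exact (hS a).nonneg fun n => mul_nonneg (ρ.population_nonneg n) (hg0 a n)

/-- The law `ℙ^ρ` of the outcome sequence for the initial state `ρ`: the probability measure on
`Ω` with `ℙ^ρ(z₁ = ω₁, …, z_t = ω_t) = Tr(ρ W_t(ω)⋆ W_t(ω))` for all `t` and `ω`. (The cylinder
sets form a generating π-system, so there is exactly one.) -/
def law (ρ : State) : Measure Trajectory := (M.exists_law ρ).choose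

theorem isProbabilityMeasure_law (ρ : State) : IsProbabilityMeasure (M.law ρ) :=
  (M.exists_law ρ).choose_spec.1

theorem law_cylinder (ρ : State) (t : ℕ) (ω : Trajectory) :
    M.law ρ {z | ∀ i < t, z i = ω i} =
      ENNReal.ofReal (trace (ρ.op * (star (M.W t ω) * M.W t ω))).re :=
  (M.exists_law ρ).choose_spec.2 t ω

theorem norm_gibbs_le (hβ : 0 < M.β) (n : ℕ) : ‖((Real.exp (-M.β * M.ε * n) : ℝ) : ℂ)‖ ≤ 1 := by
  have := M.ε_pos
  rw [Complex.norm_real, Real.norm_of_nonneg (Real.exp_pos _).le, Real.exp_le_one_iff]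
  have : 0 ≤ M.β * M.ε * n := by positivity
  linarith

/-- The Gibbs operator `e^{-βεN}`, for `β > 0`. -/
def gibbs (hβ : 0 < M.β) : Op :=
  numberFn (fun n => ((Real.exp (-M.β * M.ε * n) : ℝ) : ℂ)) ⟨1, M.norm_gibbs_le hβ⟩

theorem inner_gibbs (hβ : 0 < M.β) (n : ℕ) : inner ℂ (fock n) (M.gibbs hβ (fock n)) =
    ((Real.exp (-M.β * M.ε * n) : ℝ) : ℂ) := by
  rw [inner_fock, gibbs, numberFn_apply, fock_apply]; simp

theorem summable_gibbs (hβ : 0 < M.β) : Summable fun n : ℕ => Real.exp (-M.β * M.ε * n) := by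
  have h : 0 < M.β * M.ε := mul_pos hβ M.ε_pos
  have : ∀ n : ℕ, Real.exp (-M.β * M.ε * n) = Real.exp (-(M.β * M.ε)) ^ n := by
    intro n; rw [← Real.exp_nat_mul]; ring_nf
  simp_rw [this]
  exact summable_geometric_of_lt_one (Real.exp_pos _).le (Real.exp_lt_one_iff.2 (by linarith))

theorem trace_gibbs (hβ : 0 < M.β) : trace (M.gibbs hβ) = ((∑' n : ℕ, Real.exp (-M.β * M.ε * n) : ℝ) : ℂ) := by
  rw [trace, tsum_congr (M.inner_gibbs hβ), Complex.ofReal_tsum]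

theorem partition_pos (hβ : 0 < M.β) : 0 < ∑' n : ℕ, Real.exp (-M.β * M.ε * n) :=
  (M.summable_gibbs hβ).tsum_pos (fun _ => (Real.exp_pos _).le) 0 (Real.exp_pos _)

theorem isPositive_gibbs (hβ : 0 < M.β) : (M.gibbs hβ).IsPositive := by
  have h0 : ∀ n : ℕ, ‖((Real.exp (-M.β * M.ε * n / 2) : ℝ) : ℂ)‖ ≤ 1 := by
    intro n
    have := M.ε_pos
    rw [Complex.norm_real, Real.norm_of_nonneg (Real.exp_pos _).le, Real.exp_le_one_iff]
    have : 0 ≤ M.β * M.ε * n := by positivity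
    linarith
  have h : M.gibbs hβ = star (numberFn (fun n => ((Real.exp (-M.β * M.ε * n / 2) : ℝ) : ℂ)) ⟨1, h0⟩)
      * numberFn (fun n => ((Real.exp (-M.β * M.ε * n / 2) : ℝ) : ℂ)) ⟨1, h0⟩ := by
    ext x n
    rw [mul_apply_eq_comp, star_numberFn_apply, numberFn_apply, gibbs, numberFn_apply,
      Complex.conj_ofReal, ← mul_assoc, ← Complex.ofReal_mul, ← Real.exp_add]
    congr 3
    ring
  rw [h, ← ContinuousLinearMap.nonneg_iff_isPositive]
  exact star_mul_self_nonneg _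

/-- The Gibbs state `ρ_inv = e^{-βεN} / Tr(e^{-βεN})`, for `β > 0`. -/
def rhoInv (hβ : 0 < M.β) : State where
  op := (trace (M.gibbs hβ))⁻¹ • M.gibbs hβ
  isPositive := by
    rw [trace_gibbs, ← Complex.ofReal_inv]
    exact (M.isPositive_gibbs hβ).smul_of_nonneg (by
      have := M.partition_pos hβ
      rw [Complex.zero_le_real]
      positivity)
  traceClass := by
    have hpos : ((trace (M.gibbs hβ))⁻¹ • M.gibbs hβ).IsPositive := by
      rw [trace_gibbs, ← Complex.ofReal_inv]
      exact (M.isPositive_gibbs hβ).smul_of_nonneg (by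
        have := M.partition_pos hβ
        rw [Complex.zero_le_real]
        positivity)
    rw [traceNorm, opAbs_of_isPositive hpos]
    have h := ((M.summable_gibbs hβ).mul_left
      (∑' n : ℕ, Real.exp (-M.β * M.ε * n))⁻¹).tsum_ofReal_ne_top
    convert h using 5 with n
    rw [smul_apply, inner_smul_right, M.inner_gibbs hβ, trace_gibbs, ← Complex.ofReal_inv,
      ← Complex.ofReal_mul, Complex.ofReal_re]
  trace_eq_one := by
    have h : trace ((trace (M.gibbs hβ))⁻¹ • M.gibbs hβ) =
        (trace (M.gibbs hβ))⁻¹ * trace (M.gibbs hβ) := by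
      conv_lhs => rw [trace]
      conv_rhs => rw [trace.eq_1 (M.gibbs hβ), ← tsum_mul_left]
      refine tsum_congr fun n => ?_
      rw [smul_apply, inner_smul_right, ← trace.eq_1 (M.gibbs hβ)]
    rw [h, inv_mul_cancel₀]
    rw [trace_gibbs]
    exact_mod_cast (M.partition_pos hβ).ne'

/-- `M_t(ω) = ρ_inv^{1/2} W_t⋆ W_t ρ_inv^{1/2} / Tr(W_t⋆ W_t ρ_inv)`. -/
def Mt (hβ : 0 < M.β) (t : ℕ) (ω : Trajectory) : Op :=
  (trace (star (M.W t ω) * M.W t ω * (M.rhoInv hβ).op))⁻¹ •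
    (opSqrt (M.rhoInv hβ).op * star (M.W t ω) * M.W t ω * opSqrt (M.rhoInv hβ).op)

end Maser

end OneAtomMaser

end

/-! Conjugation by the Kraus operators preserves diagonality in the Fock basis, so `W_t⋆ W_t` is
diagonal. Its `n`-th entry `lik` is the probability of the recorded outcomes for a birth-death chain
of photon numbers started at `n` (`isDiag_lik`). Only populations matter: each law is the mixture of
the `pureLaw n` weighted by the populations of the initial state (`law_eq_sum`).

The outcomes record every jump of this chain, so the record fixes the path up to its starting point.
Non-resonance makes every transition rate positive and `β > 0` favours losses over gains, so the
chain reaches `0` almost surely (`pureLaw_neverZero`). Since it never becomes negative, its start is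
the largest net loss in the record (`ae_inferredNumber_eq`). The laws `pureLaw n` are thus carried
by disjoint events, which gives the density and the distribution of the limit.

`M_t` is diagonal, and its entries are the conditional probabilities of the events `inferredNumber =
n` given the first `t` outcomes (`isDiag_Mt`, `posterior_eq`). By Lévy's upward theorem the entry at
the true `n` tends to `1`, and the trace distance to `|n⟩⟨n|` is at most twice the missing mass. -/

noncomputable section

namespace OneAtomMaser

/-! ### Sequences over a finite alphabet -/

section Sequences

variable {α : Type*}

/-- The first `t` letters of a sequence. -/
def initialWord (t : ℕ) (z : ℕ → α) : Fin t → α := fun i => z i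

/-- The sequence with first letter `y` followed by `z`. -/
def consSeq (y : α) (z : ℕ → α) : ℕ → α
  | 0 => y
  | n + 1 => z n

/-- As fibres of a map to words, cylinders over a finite alphabet can be handled by testing on
singletons of a finite type. -/
theorem setOf_eq_initialWord_preimage (t : ℕ) (ω : ℕ → α) :
    {z : ℕ → α | ∀ i < t, z i = ω i} = initialWord t ⁻¹' {initialWord t ω} := by
  ext z
  simp only [Set.mem_ofPred_eq, Set.mem_preimage, Set.mem_singleton_iff, initialWord, funext_iff]
  exact ⟨fun h i => h i i.2, fun h i hi => h ⟨i, hi⟩⟩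

theorem initialWord_surjective [Nonempty α] (t : ℕ) :
    Function.Surjective (initialWord (α := α) t) := by
  obtain ⟨a⟩ := ‹Nonempty α›
  intro w
  refine ⟨fun i => if h : i < t then w ⟨i, h⟩ else a, ?_⟩
  ext i
  simp [initialWord]

variable [MeasurableSpace α]

theorem measurable_initialWord (t : ℕ) : Measurable (initialWord (α := α) t) := by
  unfold initialWord; fun_prop

theorem measurable_consSeq (y : α) : Measurable (consSeq y) := by
  rw [measurable_pi_iff]
  rintro (_ | n)
  · exact measurable_const
  · exact measurable_pi_apply n

theorem measurableSet_cylinder [MeasurableSingletonClass α] (t : ℕ) (ω : ℕ → α) :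
    MeasurableSet {z : ℕ → α | ∀ i < t, z i = ω i} := by
  rw [setOf_eq_initialWord_preimage]
  exact measurable_initialWord t (MeasurableSet.singleton _)

/-- A finite measure on sequences is determined by the weights of cylinders. -/
theorem ext_of_cylinder [Finite α] [Nonempty α] [MeasurableSingletonClass α]
    {μ ν : Measure (ℕ → α)} [IsFiniteMeasure μ]
    (h : ∀ t (ω : ℕ → α), μ {z | ∀ i < t, z i = ω i} = ν {z | ∀ i < t, z i = ω i}) : μ = ν := by
  have h1 : ∀ t, μ.map (initialWord t) = ν.map (initialWord t) := by
    intro t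
    refine Measure.ext_of_singleton fun w => ?_
    obtain ⟨ω, rfl⟩ := initialWord_surjective t w
    rw [Measure.map_apply (measurable_initialWord t) (MeasurableSet.singleton _),
      Measure.map_apply (measurable_initialWord t) (MeasurableSet.singleton _),
      ← setOf_eq_initialWord_preimage, h]
  -- A finite set of coordinates lies in an initial segment, so its marginal is an image of a word
  -- marginal. Uniqueness of projective limits then finishes.
  have h2 : ∀ I : Finset ℕ, μ.map I.restrict = ν.map I.restrict := by
    intro I
    obtain ⟨t, ht⟩ : ∃ t, ∀ i ∈ I, i < t := ⟨I.sup id + 1, fun i hi =>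
      Nat.lt_succ_of_le (Finset.le_sup (f := id) hi)⟩
    let g : (Fin t → α) → (I → α) := fun w i => w ⟨i, ht i i.2⟩
    have hg : Measurable g := by fun_prop
    have : (I.restrict : (ℕ → α) → (I → α)) = g ∘ initialWord t := rfl
    rw [this, ← Measure.map_map hg (measurable_initialWord t), h1,
      Measure.map_map hg (measurable_initialWord t)]
  have hμ : IsProjectiveLimit (α := fun _ : ℕ => α) μ (fun I => μ.map I.restrict) := fun I => rfl
  have hν : IsProjectiveLimit (α := fun _ : ℕ => α) ν (fun I => μ.map I.restrict) :=
    fun I => (h2 I).symm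
  have : ∀ I : Finset ℕ, IsFiniteMeasure ((fun I : Finset ℕ => μ.map I.restrict) I) :=
    fun I => inferInstance
  exact hμ.unique hν

/-- The filtration generated by the letters of a sequence. -/
def wordFiltration : Filtration ℕ (MeasurableSpace.pi : MeasurableSpace (ℕ → α)) where
  seq t := MeasurableSpace.comap (initialWord t) inferInstance
  mono' := by
    intro s t hst
    have hg : Measurable (fun (w : Fin t → α) (i : Fin s) => w ⟨i, by omega⟩) := by fun_prop
    have : initialWord (α := α) s =
      (fun (w : Fin t → α) (i : Fin s) => w ⟨i, by omega⟩) ∘ initialWord t := rfl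
    change MeasurableSpace.comap (initialWord s) _ ≤ _
    rw [this, ← MeasurableSpace.comap_comp]
    exact MeasurableSpace.comap_mono hg.comap_le
  le' t := (measurable_initialWord t).comap_le

/-- Needed in Lévy's theorem: since the letters generate everything, the limit is the indicator of
the event itself and not a conditional expectation. -/
theorem iSup_wordFiltration :
    ⨆ t, wordFiltration (α := α) t = (MeasurableSpace.pi : MeasurableSpace (ℕ → α)) := by
  refine le_antisymm (iSup_le fun t => wordFiltration.le t) ?_
  refine iSup_le fun i => le_trans ?_ (le_iSup _ (i + 1))
  have hg : Measurable (fun w : Fin (i + 1) → α => w (Fin.last i)) := by fun_prop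
  have : (fun z : ℕ → α => z i) = (fun w : Fin (i + 1) → α => w (Fin.last i)) ∘
    initialWord (i + 1) := rfl
  rw [this, ← MeasurableSpace.comap_comp]
  exact MeasurableSpace.comap_mono hg.comap_le

/-- Almost sure convergence of conditional probabilities given the first letters. -/
theorem tendsto_cylinder_ratio [Finite α] [Nonempty α] [MeasurableSingletonClass α]
    (μ : Measure (ℕ → α)) [IsFiniteMeasure μ] {A : Set (ℕ → α)} (hA : MeasurableSet A) :
    ∀ᵐ ω ∂μ, Tendsto (fun t => μ.real ({z | ∀ i < t, z i = ω i} ∩ A) /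
      μ.real {z | ∀ i < t, z i = ω i}) atTop (𝓝 (A.indicator 1 ω)) := by
  classical
  have hf : Integrable (A.indicator (1 : (ℕ → α) → ℝ)) μ :=
    (integrable_const (1 : ℝ)).indicator hA
  have hlim := hf.tendsto_ae_condExp (ℱ := wordFiltration) (by
    rw [iSup_wordFiltration]
    exact (stronglyMeasurable_const (b := (1 : ℝ))).indicator hA)
  -- The elementary conditional probability given the word `w`; composed with `initialWord t` it is
  -- a version of the conditional expectation.
  let φ : (t : ℕ) → (Fin t → α) → ℝ := fun t w =>
    μ.real (initialWord t ⁻¹' {w} ∩ A) / μ.real (initialWord t ⁻¹' {w})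
  have hmeas : ∀ t (s : Set (Fin t → α)), MeasurableSet (initialWord t ⁻¹' s) := fun t s =>
    measurable_initialWord t s.toFinite.measurableSet
  have hφm : ∀ t, Measurable (φ t) := fun t => measurable_of_finite _
  have hφi : ∀ t, Integrable (fun z => φ t (initialWord t z)) μ := by
    intro t
    obtain ⟨K, hK⟩ := (Set.finite_range fun w => ‖φ t w‖).bddAbove
    exact Integrable.of_bound ((hφm t).comp (measurable_initialWord t)).aestronglyMeasurable K
      (ae_of_all _ fun z => hK ⟨_, rfl⟩)
  have hcond : ∀ t, (fun z => φ t (initialWord t z)) =ᵐ[μ]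
      μ[A.indicator (1 : (ℕ → α) → ℝ) | wordFiltration t] := by
    intro t
    refine ae_eq_condExp_of_forall_setIntegral_eq (wordFiltration.le t) hf
      (fun _ _ _ => (hφi t).integrableOn) ?_ ?_
    · rintro _ ⟨s, -, rfl⟩ -
      -- An event of the `t`-th σ-algebra is a finite disjoint union of cylinders, and on each of
      -- them `φ` is constant.
      have hs : initialWord (α := α) t ⁻¹' s =
          ⋃ w ∈ s.toFinite.toFinset, initialWord t ⁻¹' {w} := by
        ext z; simp
      have hd : (s.toFinite.toFinset : Set (Fin t → α)).Pairwise
          (Function.onFun Disjoint fun w => initialWord (α := α) t ⁻¹' {w}) := by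
        intro w _ w' _ hw
        exact Disjoint.preimage _ (by simpa using hw)
      rw [hs, integral_biUnion_finset _ (fun w _ => hmeas t _) hd
        (fun w _ => (hφi t).integrableOn),
        integral_biUnion_finset _ (fun w _ => hmeas t _) hd (fun w _ => hf.integrableOn)]
      refine Finset.sum_congr rfl fun w _ => ?_
      have e1 : ∫ z in initialWord t ⁻¹' {w}, φ t (initialWord t z) ∂μ =
          ∫ z in initialWord t ⁻¹' {w}, φ t w ∂μ := by
        refine setIntegral_congr_fun (hmeas t _) fun z hz => ?_
        simp only [Set.mem_preimage, Set.mem_singleton_iff] at hz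
        simp only [hz]
      rw [e1, setIntegral_const, integral_indicator_one hA, measureReal_restrict_apply hA,
        smul_eq_mul, Set.inter_comm A]
      -- On a null cylinder `φ` has the default value of division by zero, but both integrals
      -- vanish.
      by_cases h0 : μ.real (initialWord t ⁻¹' {w}) = 0
      · rw [h0, zero_mul, eq_comm]
        exact measureReal_mono_null Set.inter_subset_left h0
      · simp only [φ]; field_simp
    · refine (Measurable.stronglyMeasurable ?_).aestronglyMeasurable
      exact (hφm t).comp (comap_measurable (initialWord t))
  have hall := ae_all_iff.2 hcond
  filter_upwards [hlim, hall] with ω h1 h2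
  refine h1.congr fun t => ?_
  rw [← h2 t, setOf_eq_initialWord_preimage]

end Sequences

/-! ### Square roots and absolute values of bounded operators -/

section Operators

variable {H : Type*} [NormedAddCommGroup H] [InnerProductSpace ℂ H] [CompleteSpace H]

theorem opSqrt_eq_of_mul_self {A B : H →L[ℂ] H} (h : B * B = A) (hB : 0 ≤ B) : opSqrt A = B :=
  CFC.sqrt_unique h hB

theorem opAbs_eq_opSqrt (A : H →L[ℂ] H) : opAbs A = opSqrt (star A * A) := rfl

end Operators

/-! ### Diagonal operators -/

namespace Maser

theorem IsDiag.mul {A B : Op} {f g : ℕ → ℂ} (hA : IsDiag A f) (hB : IsDiag B g) :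
    IsDiag (A * B) (fun n => f n * g n) := by
  intro x n
  rw [mul_apply_eq_comp, hA, hB, mul_assoc]

theorem IsDiag.sub {A B : Op} {f g : ℕ → ℂ} (hA : IsDiag A f) (hB : IsDiag B g) :
    IsDiag (A - B) (fun n => f n - g n) := by
  intro x n
  rw [sub_apply, lp.coeFn_sub, Pi.sub_apply, hA, hB, sub_mul]

theorem IsDiag.smul {A : Op} {f : ℕ → ℂ} (c : ℂ) (hA : IsDiag A f) :
    IsDiag (c • A) (fun n => c * f n) := by
  intro x n
  rw [smul_apply, lp.coeFn_smul, Pi.smul_apply, hA, smul_eq_mul, mul_assoc]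

theorem IsDiag.ext {A B : Op} {f : ℕ → ℂ} (hA : IsDiag A f) (hB : IsDiag B f) : A = B := by
  ext x n
  rw [hA, hB]

theorem isDiag_numberFn (f : ℕ → ℂ) (hf) : IsDiag (numberFn f hf) f := numberFn_apply f hf

theorem IsDiag.star {A : Op} {f : ℕ → ℂ} (hA : IsDiag A f) :
    IsDiag (star A) (fun n => starRingEnd ℂ (f n)) := by
  intro x n
  have : A (fock n) = f n • fock n := by
    ext m
    rw [hA, lp.coeFn_smul, Pi.smul_apply, fock_apply]
    split_ifs with h
    · rw [h]; simp
    · simp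
  rw [star_apply_coord, this, inner_smul_left, inner_fock]

theorem IsDiag.inner_fock_apply {A : Op} {f : ℕ → ℂ} (hA : IsDiag A f) (n : ℕ) :
    inner ℂ (fock n) (A (fock n)) = f n := by
  rw [inner_fock, hA, fock_apply]; simp

theorem norm_fock (n : ℕ) : ‖fock n‖ = 1 := by
  rw [fock, lp.norm_single (by norm_num)]; simp

theorem IsDiag.norm_le {A : Op} {f : ℕ → ℂ} (hA : IsDiag A f) (n : ℕ) : ‖f n‖ ≤ ‖A‖ := by
  rw [← hA.inner_fock_apply n]
  calc ‖inner ℂ (fock n) (A (fock n))‖ ≤ ‖fock n‖ * ‖A (fock n)‖ := norm_inner_le_norm _ _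
    _ ≤ ‖fock n‖ * (‖A‖ * ‖fock n‖) := by gcongr; exact A.le_opNorm _
    _ = ‖A‖ := by rw [norm_fock]; simp

theorem IsDiag.nonneg {A : Op} {f : ℕ → ℝ} (hA : IsDiag A (fun n => (f n : ℂ)))
    (hf : ∀ n, 0 ≤ f n) : 0 ≤ A := by
  have hb : ∀ n, ‖((√(f n) : ℝ) : ℂ)‖ ≤ √‖A‖ := by
    intro n
    rw [Complex.norm_real, Real.norm_of_nonneg (Real.sqrt_nonneg _)]
    refine Real.sqrt_le_sqrt ?_
    have := hA.norm_le n
    rwa [Complex.norm_real, Real.norm_of_nonneg (hf n)] at this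
  have hB := isDiag_numberFn (fun n => ((√(f n) : ℝ) : ℂ)) ⟨_, hb⟩
  have : A = Star.star (numberFn (fun n => ((√(f n) : ℝ) : ℂ)) ⟨_, hb⟩) *
      numberFn (fun n => ((√(f n) : ℝ) : ℂ)) ⟨_, hb⟩ := by
    refine hA.ext ?_
    convert hB.star.mul hB using 2 with n
    rw [Complex.conj_ofReal, ← Complex.ofReal_mul, Real.mul_self_sqrt (hf n)]
  rw [this]
  exact star_mul_self_nonneg _

/-- The entrywise root is bounded by `√‖A‖`, is nonnegative and squares to `A`; uniqueness of the
positive square root identifies it. -/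
theorem IsDiag.opSqrt {A : Op} {f : ℕ → ℝ} (hA : IsDiag A (fun n => (f n : ℂ)))
    (hf : ∀ n, 0 ≤ f n) : IsDiag (opSqrt A) (fun n => ((√(f n) : ℝ) : ℂ)) := by
  have hb : ∀ n, ‖((√(f n) : ℝ) : ℂ)‖ ≤ √‖A‖ := by
    intro n
    rw [Complex.norm_real, Real.norm_of_nonneg (Real.sqrt_nonneg _)]
    refine Real.sqrt_le_sqrt ?_
    have := hA.norm_le n
    rwa [Complex.norm_real, Real.norm_of_nonneg (hf n)] at this
  have hB := isDiag_numberFn (fun n => ((√(f n) : ℝ) : ℂ)) ⟨_, hb⟩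
  have h1 : numberFn (fun n => ((√(f n) : ℝ) : ℂ)) ⟨_, hb⟩ *
      numberFn (fun n => ((√(f n) : ℝ) : ℂ)) ⟨_, hb⟩ = A := by
    refine IsDiag.ext ?_ hA
    convert hB.mul hB using 2 with n
    rw [← Complex.ofReal_mul, Real.mul_self_sqrt (hf n)]
  rw [opSqrt_eq_of_mul_self h1 (hB.nonneg fun n => Real.sqrt_nonneg _)]
  exact hB

theorem IsDiag.opAbs {A : Op} {f : ℕ → ℂ} (hA : IsDiag A f) :
    IsDiag (opAbs A) (fun n => ((‖f n‖ : ℝ) : ℂ)) := by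
  have h : IsDiag (Star.star A * A) (fun n => ((‖f n‖ ^ 2 : ℝ) : ℂ)) := by
    convert hA.star.mul hA using 2 with n
    rw [← Complex.normSq_eq_conj_mul_self, Complex.normSq_eq_norm_sq]
  have h2 := h.opSqrt fun n => sq_nonneg _
  simp_rw [Real.sqrt_sq (norm_nonneg _)] at h2
  rwa [opAbs_eq_opSqrt]

/-- Reduces trace-norm convergence of diagonal operators to `ℓ¹` convergence of their entries. -/
theorem IsDiag.traceNorm {A : Op} {f : ℕ → ℂ} (hA : IsDiag A f) :
    traceNorm A = ∑' n, ENNReal.ofReal ‖f n‖ := by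
  simp only [OneAtomMaser.traceNorm, hA.opAbs.inner_fock_apply, Complex.ofReal_re]

theorem isDiag_fockProj (n : ℕ) : IsDiag (fockProj n) (fun m => if m = n then 1 else 0) := by
  intro x m
  rw [fockProj, InnerProductSpace.rankOne_apply, lp.coeFn_smul, Pi.smul_apply, fock_apply,
    inner_fock]
  split_ifs with h
  · simp [h]
  · simp [h]

end Maser

open Maser

/-- The pure state `|n⟩⟨n|`. -/
def pureState (n : ℕ) : State where
  op := fockProj n
  isPositive := by
    rw [← ContinuousLinearMap.nonneg_iff_isPositive]
    refine IsDiag.nonneg (f := fun m => if m = n then 1 else 0) ?_ fun m => by positivity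
    convert isDiag_fockProj n using 2 with m
    split_ifs <;> simp
  traceClass := by
    rw [(isDiag_fockProj n).traceNorm, tsum_eq_single n]
    · simp
    · intro m hm; simp [hm]
  trace_eq_one := by
    simp only [trace, (isDiag_fockProj n).inner_fock_apply]
    simp

theorem population_pureState (n m : ℕ) :
    (pureState n).population m = if m = n then 1 else 0 := by
  rw [State.population, pureState, (isDiag_fockProj n).inner_fock_apply]
  split_ifs <;> simp

/-! ### The likelihood of the outcomes -/

/-- The photon number after the outcome `y`, if it was `n` before. -/
def move (n : ℕ) : Outcome → ℕ
  | (false, false) => n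
  | (false, true) => n - 1
  | (true, false) => n + 1
  | (true, true) => n

namespace Maser

variable (M : Maser)

/-- The probability `S(n)²n` of a transition between `|n-1⟩` and `|n⟩`. -/
def rabi (n : ℕ) : ℝ := M.S n ^ 2 * n

theorem rabi_zero : M.rabi 0 = 0 := by simp [rabi]

theorem rabi_nonneg (n : ℕ) : 0 ≤ M.rabi n := by unfold rabi; positivity

theorem rabi_le_one (n : ℕ) : M.rabi n ≤ 1 := by
  have := M.normSq_C_add n
  have := Complex.normSq_nonneg (M.C n)
  unfold rabi; linarith

/-- The sine in `S n` vanishes only when `√(ξn+η)` is an integer, which is exactly a Rabi resonance.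
No level `n ≥ 1` therefore blocks the chain. -/
theorem rabi_pos (h : M.NonResonant) {n : ℕ} (hn : 0 < n) : 0 < M.rabi n := by
  have hξ := M.ξ_pos
  have hη := M.η_nonneg
  have hx : 0 < M.ξ * n + M.η := by positivity
  have hsin : Real.sin (Real.pi * √(M.ξ * n + M.η)) ≠ 0 := by
    intro h0
    obtain ⟨k, hk⟩ := Real.sin_eq_zero_iff.1 h0
    have hk2 : (k : ℝ) = √(M.ξ * n + M.η) := by
      have := Real.pi_ne_zero
      field_simp at hk
      linarith
    have hkpos : 0 < k := by
      have : (0 : ℝ) < k := by rw [hk2]; positivity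
      exact_mod_cast this
    lift k to ℕ using hkpos.le
    refine h n k hn (by exact_mod_cast hkpos) ?_
    rw [← Real.sq_sqrt hx.le, ← hk2]
    simp
  have hS : M.S n ≠ 0 := by
    unfold S
    have : √(M.ξ * n + M.η) ≠ 0 := by positivity
    have : √M.ξ ≠ 0 := by positivity
    positivity
  unfold rabi
  positivity

/-- The probability of the outcome `y` if the photon number is `n`. -/
def outcomeProb (n : ℕ) : Outcome → ℝ
  | (false, false) => M.pAt false * (1 - M.rabi n)
  | (false, true) => M.pAt false * M.rabi n
  | (true, false) => M.pAt true * M.rabi (n + 1)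
  | (true, true) => M.pAt true * (1 - M.rabi (n + 1))

/-- Reads the Kraus action on diagonal operators as one step of a Markov chain: outcome `y` has
probability `outcomeProb n y` and moves `n` to `move n y`. -/
theorem krausDiag_eq (f : ℕ → ℂ) (y : Outcome) (n : ℕ) :
    M.krausDiag f y n = (M.outcomeProb n y : ℂ) * f (move n y) := by
  obtain ⟨_ | _, _ | _⟩ := y <;> rfl

theorem outcomeProb_nonneg (n : ℕ) (y : Outcome) : 0 ≤ M.outcomeProb n y := by
  have h1 := M.pAt_nonneg
  have h2 := M.rabi_nonneg
  have h3 := M.rabi_le_one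
  obtain ⟨_ | _, _ | _⟩ := y <;> simp only [outcomeProb] <;>
    refine mul_nonneg (h1 _) ?_ <;> first | exact h2 _ | exact sub_nonneg.2 (h3 _)

theorem sum_outcomeProb (n : ℕ) : ∑ y, M.outcomeProb n y = 1 := by
  rw [Fintype.sum_prod_type]
  simp only [Fintype.sum_bool, outcomeProb]
  linear_combination M.pAt_add

/-- The probability of the first `t` outcomes of `ω` if the initial photon number is `n`. -/
def lik : ℕ → Trajectory → ℕ → ℝ
  | 0, _, _ => 1
  | t + 1, ω, n => M.outcomeProb n (ω 0) * lik t (fun i => ω (i + 1)) (move n (ω 0))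

theorem lik_nonneg (t : ℕ) (ω : Trajectory) (n : ℕ) : 0 ≤ M.lik t ω n := by
  induction t generalizing ω n with
  | zero => exact zero_le_one
  | succ t ih => exact mul_nonneg (M.outcomeProb_nonneg _ _) (ih _ _)

/-- `W` adds the last outcome on the left, whereas `lik` conditions on the first one; this peels `W`
from the other end. -/
theorem W_succ_eq (t : ℕ) (ω : Trajectory) :
    M.W (t + 1) ω = M.W t (fun i => ω (i + 1)) * M.kraus (ω 0) := by
  induction t with
  | zero => simp [W]
  | succ t ih => rw [W, ih, W, mul_assoc]

theorem isDiag_lik (t : ℕ) (ω : Trajectory) :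
    IsDiag (star (M.W t ω) * M.W t ω) (fun n => (M.lik t ω n : ℂ)) := by
  induction t generalizing ω with
  | zero => intro x n; simp [W, lik]
  | succ t ih =>
    have h := M.isDiag_kraus (ih fun i => ω (i + 1)) (ω 0)
    convert h using 1
    · rw [W_succ_eq, star_mul]
      simp only [mul_assoc]
    · ext n
      rw [krausDiag_eq, lik, Complex.ofReal_mul]

theorem hasSum_lik (ρ : State) (t : ℕ) (ω : Trajectory) :
    HasSum (fun n => ρ.population n * M.lik t ω n)
      (trace (ρ.op * (star (M.W t ω) * M.W t ω))).re := by
  simpa using hasSum_trace_mul ρ (M.isDiag_lik t ω)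

theorem law_cylinder_eq_tsum (ρ : State) (t : ℕ) (ω : Trajectory) :
    M.law ρ {z | ∀ i < t, z i = ω i} =
      ∑' n, ENNReal.ofReal (ρ.population n) * ENNReal.ofReal (M.lik t ω n) := by
  rw [law_cylinder, ← (M.hasSum_lik ρ t ω).tsum_eq, ENNReal.ofReal_tsum_of_nonneg]
  · exact tsum_congr fun n => ENNReal.ofReal_mul (ρ.population_nonneg n)
  · exact fun n => mul_nonneg (ρ.population_nonneg n) (M.lik_nonneg t ω n)
  · exact (M.hasSum_lik ρ t ω).summable

/-- The law of the outcomes if the initial photon number is `n`. -/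
def pureLaw (n : ℕ) : Measure Trajectory := M.law (pureState n)

instance (n : ℕ) : IsProbabilityMeasure (M.pureLaw n) := M.isProbabilityMeasure_law _

theorem pureLaw_cylinder (n t : ℕ) (ω : Trajectory) :
    M.pureLaw n {z | ∀ i < t, z i = ω i} = ENNReal.ofReal (M.lik t ω n) := by
  rw [pureLaw, law_cylinder_eq_tsum, tsum_eq_single n]
  · simp [population_pureState]
  · intro m hm; simp [population_pureState, hm]

/-- Only the populations of the initial state matter. -/
theorem law_eq_sum (ρ : State) :
    M.law ρ = Measure.sum fun n => ENNReal.ofReal (ρ.population n) • M.pureLaw n := by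
  have := M.isProbabilityMeasure_law ρ
  refine ext_of_cylinder fun t ω => ?_
  rw [law_cylinder_eq_tsum, Measure.sum_apply _ (measurableSet_cylinder t ω)]
  simp [pureLaw_cylinder]

/-- The Markov property at the first step. -/
theorem pureLaw_eq_sum (n : ℕ) : M.pureLaw n = ∑ y, ENNReal.ofReal (M.outcomeProb n y) •
    (M.pureLaw (move n y)).map (consSeq y) := by
  refine ext_of_cylinder fun t ω => ?_
  simp only [Measure.coe_finsetSum, Finset.sum_apply, Measure.smul_apply, smul_eq_mul]
  -- The empty cylinder condition gives the total mass, where all outcomes contribute; for longer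
  -- words only the outcome `ω 0` does.
  cases t with
  | zero =>
    have hP : ∀ y, ((M.pureLaw (move n y)).map (consSeq y)) Set.univ = 1 := fun y => by
      rw [Measure.map_apply (measurable_consSeq y) MeasurableSet.univ]; simp
    simp only [Nat.not_lt_zero, false_imp_iff, implies_true, Set.ofPred_true, measure_univ,
      hP, mul_one]
    rw [← ENNReal.ofReal_sum_of_nonneg fun y _ => M.outcomeProb_nonneg n y, sum_outcomeProb,
      ENNReal.ofReal_one]
  | succ t =>
    rw [pureLaw_cylinder, lik, Finset.sum_eq_single (ω 0)]
    · rw [Measure.map_apply (measurable_consSeq _) (measurableSet_cylinder _ _),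
        ENNReal.ofReal_mul (M.outcomeProb_nonneg _ _), ← pureLaw_cylinder]
      congr 2
      ext z
      constructor
      · rintro h (_ | i) hi
        · rfl
        · exact h i (by omega)
      · exact fun h i hi => h (i + 1) (by omega)
    · intro y _ hy
      rw [Measure.map_apply (measurable_consSeq _) (measurableSet_cylinder _ _)]
      have : consSeq y ⁻¹' {z | ∀ i < t + 1, z i = ω i} = ∅ := by
        ext z
        simp only [Set.mem_preimage, Set.mem_ofPred_eq, Set.mem_empty_iff_false, iff_false]
        exact fun h => hy (h 0 (by omega))
      rw [this]; simp
    · simp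

theorem pureLaw_real_eq_sum (n : ℕ) {A : Set Trajectory} (hA : MeasurableSet A) :
    (M.pureLaw n).real A = ∑ y, M.outcomeProb n y *
      (M.pureLaw (move n y)).real (consSeq y ⁻¹' A) := by
  rw [measureReal_def, M.pureLaw_eq_sum n]
  simp only [Measure.coe_finsetSum, Finset.sum_apply, Measure.smul_apply, smul_eq_mul,
    Measure.map_apply (measurable_consSeq _) hA]
  rw [ENNReal.toReal_sum fun y _ => ENNReal.mul_ne_top ENNReal.ofReal_ne_top (measure_ne_top _ _)]
  refine Finset.sum_congr rfl fun y _ => ?_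
  rw [ENNReal.toReal_mul, ENNReal.toReal_ofReal (M.outcomeProb_nonneg _ _), measureReal_def]

end Maser

/-! ### The displacement of the photon number and recurrence -/

/-- The change of the photon number recorded by an outcome. -/
def outcomeShift : Outcome → ℤ
  | (false, true) => -1
  | (true, false) => 1
  | _ => 0

/-- The change of the photon number recorded by the first `t` outcomes. -/
def displacement (t : ℕ) (ω : Trajectory) : ℤ := ∑ i ∈ Finset.range t, outcomeShift (ω i)

theorem displacement_zero (ω : Trajectory) : displacement 0 ω = 0 := rfl

theorem displacement_consSeq (t : ℕ) (y : Outcome) (ω : Trajectory) :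
    displacement (t + 1) (consSeq y ω) = outcomeShift y + displacement t ω := by
  rw [displacement, Finset.sum_range_succ', add_comm]; rfl

theorem measurable_displacement (t : ℕ) : Measurable (displacement t) := by
  unfold displacement
  exact Finset.measurable_sum _ fun i _ => (measurable_of_finite outcomeShift).comp (measurable_pi_apply i)

theorem move_eq {n : ℕ} (hn : 0 < n) (y : Outcome) : (move n y : ℤ) = n + outcomeShift y := by
  obtain ⟨_ | _, _ | _⟩ := y <;> simp [move, outcomeShift]
  omega

/-- The initial photon number inferred from the outcomes: the largest net loss recorded. -/
def inferredNumber (ω : Trajectory) : ℕ := ⨆ t, (-displacement t ω).toNat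

theorem measurable_inferredNumber : Measurable inferredNumber :=
  Measurable.iSup fun t => (measurable_of_countable fun k : ℤ => (-k).toNat).comp
    (measurable_displacement t)

/-- Nonnegativity of the path bounds the net loss by `n`, and a visit to `0` attains this bound. The
bound also keeps the supremum in `ℕ` from taking its default value. -/
theorem inferredNumber_eq {n : ℕ} {ω : Trajectory} (h1 : ∀ t, 0 ≤ (n : ℤ) + displacement t ω)
    (h2 : ∃ t, (n : ℤ) + displacement t ω = 0) : inferredNumber ω = n := by
  have hle : ∀ t, (-displacement t ω).toNat ≤ n := fun t => by have := h1 t; omega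
  obtain ⟨t, ht⟩ := h2
  refine le_antisymm (ciSup_le hle) ?_
  calc n = (-displacement t ω).toNat := by omega
    _ ≤ _ := le_ciSup (f := fun t => (-displacement t ω).toNat)
        ⟨n, by rintro _ ⟨t, rfl⟩; exact hle t⟩ t

/-- The trajectories along which a photon number starting from `n` never vanishes. -/
def neverZero (n : ℕ) : Set Trajectory := {ω | ∀ t, (n : ℤ) + displacement t ω ≠ 0}

theorem measurableSet_neverZero (n : ℕ) : MeasurableSet (neverZero n) := by
  have : neverZero n = ⋂ t, displacement t ⁻¹' {k | (n : ℤ) + k ≠ 0} := by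
    ext ω; simp [neverZero]
  rw [this]
  exact MeasurableSet.iInter fun t => measurable_displacement t (Set.to_countable _).measurableSet

theorem neverZero_zero : neverZero 0 = ∅ := by
  ext ω
  simp only [neverZero, Set.mem_ofPred_eq, Set.mem_empty_iff_false, iff_false]
  exact fun h => h 0 (by simp [displacement_zero])

/-- Positivity of `n` serves twice: the subtraction in `move` is not truncated, and the condition at
time `0` holds automatically. -/
theorem consSeq_preimage_neverZero {n : ℕ} (hn : 0 < n) (y : Outcome) :
    consSeq y ⁻¹' neverZero n = neverZero (move n y) := by
  ext ω
  simp only [neverZero, Set.mem_preimage, Set.mem_ofPred_eq, move_eq hn]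
  constructor
  · intro h t
    have := h (t + 1)
    rwa [displacement_consSeq, ← add_assoc] at this
  · rintro h (_ | t)
    · rw [displacement_zero]; omega
    · rw [displacement_consSeq, ← add_assoc]; exact h t

namespace Maser

variable (M : Maser)

/-- The truncated subtraction in `move` is wrong only for a loss from the vacuum, an outcome whose
probability is `0` by `rabi_zero`. -/
theorem move_eq_of_outcomeProb_ne_zero {n : ℕ} {y : Outcome} (h : M.outcomeProb n y ≠ 0) :
    (move n y : ℤ) = n + outcomeShift y := by
  rcases Nat.eq_zero_or_pos n with rfl | hn
  · obtain ⟨_ | _, _ | _⟩ := y <;> simp [move, outcomeShift]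
    simp [outcomeProb, rabi_zero] at h
  · exact move_eq hn y

theorem ae_displacement_nonneg (n : ℕ) :
    ∀ᵐ ω ∂(M.pureLaw n), ∀ t, 0 ≤ (n : ℤ) + displacement t ω := by
  rw [ae_all_iff]
  intro t
  have hm : ∀ t (n : ℕ), MeasurableSet {ω | ¬ 0 ≤ (n : ℤ) + displacement t ω} := fun t n =>
    measurable_displacement t (Set.to_countable {k | ¬ 0 ≤ (n : ℤ) + k}).measurableSet
  rw [ae_iff, ← measureReal_eq_zero_iff]
  induction t generalizing n with
  | zero => simp [displacement_zero]
  | succ t ih =>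
    rw [pureLaw_real_eq_sum _ _ (hm _ _)]
    refine Finset.sum_eq_zero fun y _ => ?_
    by_cases h : M.outcomeProb n y = 0
    · rw [h, zero_mul]
    · have : consSeq y ⁻¹' {ω | ¬ 0 ≤ (n : ℤ) + displacement (t + 1) ω} =
          {ω | ¬ 0 ≤ (move n y : ℤ) + displacement t ω} := by
        ext ω
        simp only [Set.mem_preimage, Set.mem_ofPred_eq, displacement_consSeq,
          M.move_eq_of_outcomeProb_ne_zero h, add_assoc]
      rw [this, ih, mul_zero]

/-! ### Almost sure absorption at the vacuum level -/

theorem pAt_true_pos : 0 < M.pAt true := by simp only [pAt]; positivity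

theorem pAt_true_lt (hβ : 0 < M.β) : M.pAt true < M.pAt false := by
  have h : 0 < M.β * M.ε := mul_pos hβ M.ε_pos
  simp only [pAt]
  gcongr
  rw [Real.exp_lt_one_iff]
  linarith

/-- A bounded solution of the hitting equations for `0` that vanishes at `0` vanishes. -/
theorem eq_zero_of_harmonic (hnr : M.NonResonant) (hβ : 0 < M.β) {h : ℕ → ℝ}
    (h0 : h 0 = 0) (hnn : ∀ n, 0 ≤ h n) (h1 : ∀ n, h n ≤ 1)
    (heq : ∀ n, 0 < n → h n = ∑ y, M.outcomeProb n y * h (move n y)) (n : ℕ) : h n = 0 := by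
  have hp := M.pAt_true_pos
  have hlt := M.pAt_true_lt hβ
  have hadd := M.pAt_add
  set p := M.pAt true
  set q := M.pAt false
  -- The increments of `h` weighted by the transition rates: since `p + q = 1`, the harmonic
  -- equation at `n + 1` reads `p * g (n + 1) = q * g n`.
  let g : ℕ → ℝ := fun n => M.rabi (n + 1) * (h (n + 1) - h n)
  have hg : ∀ n, g (n + 1) = q / p * g n := by
    intro n
    have := heq (n + 1) n.succ_pos
    rw [Fintype.sum_prod_type] at this
    simp only [Fintype.sum_bool, outcomeProb, move, Nat.add_sub_cancel] at this
    simp only [g]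
    field_simp
    linear_combination -this - h (n + 1) * hadd
  have hpow : ∀ n, g n = (q / p) ^ n * g 0 := by
    intro n
    induction n with
    | zero => simp
    | succ n ih => rw [hg, ih]; ring
  have hbd : ∀ n, |g n| ≤ 1 := by
    intro n
    have e1 := M.rabi_nonneg (n + 1)
    have e2 := M.rabi_le_one (n + 1)
    have e3 : |h (n + 1) - h n| ≤ 1 := by
      rw [abs_le]
      constructor <;> linarith [hnn n, hnn (n + 1), h1 n, h1 (n + 1)]
    simp only [g]
    rw [abs_mul, abs_of_nonneg e1]
    exact mul_le_one₀ e2 (abs_nonneg _) e3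
  have hr : 1 < q / p := (one_lt_div hp).2 hlt
  -- A bounded geometric sequence of ratio `q / p > 1` must vanish; here `β > 0` is decisive.
  have hg0 : g 0 = 0 := by
    by_contra hne
    obtain ⟨k, hk⟩ := pow_unbounded_of_one_lt (1 / |g 0|) hr
    have hpos : 0 < |g 0| := abs_pos.2 hne
    have := hbd k
    rw [hpow, abs_mul, abs_of_nonneg (by positivity)] at this
    rw [div_lt_iff₀ hpos] at hk
    linarith
  induction n with
  | zero => exact h0
  | succ n ih =>
    have e1 : g n = 0 := by rw [hpow, hg0, mul_zero]
    have e2 := (mul_eq_zero.1 e1).resolve_left (M.rabi_pos hnr n.succ_pos).ne'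
    linarith

/-- As a function of the start, the probability of never reaching `0` is bounded, vanishes at `0`
and is harmonic elsewhere by the Markov property. -/
theorem pureLaw_neverZero (hnr : M.NonResonant) (hβ : 0 < M.β) (n : ℕ) :
    M.pureLaw n (neverZero n) = 0 := by
  rw [← measureReal_eq_zero_iff]
  refine M.eq_zero_of_harmonic hnr hβ (h := fun n => (M.pureLaw n).real (neverZero n)) ?_
    (fun _ => measureReal_nonneg) (fun _ => measureReal_le_one) (fun n hn => ?_) n
  · rw [neverZero_zero, measureReal_empty]
  · rw [pureLaw_real_eq_sum _ _ (measurableSet_neverZero n)]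
    simp only [consSeq_preimage_neverZero hn]

/-- The initial photon number is almost surely recovered from the outcomes. -/
theorem ae_inferredNumber_eq (hnr : M.NonResonant) (hβ : 0 < M.β) (n : ℕ) :
    ∀ᵐ ω ∂(M.pureLaw n), inferredNumber ω = n := by
  filter_upwards [M.ae_displacement_nonneg n,
    measure_eq_zero_iff_ae_notMem.1 (M.pureLaw_neverZero hnr hβ n)] with ω h1 h2
  refine inferredNumber_eq h1 ?_
  simpa [neverZero] using h2

/-! ### Mutual singularity of the pure laws and the density -/

theorem measurableSet_inferredNumber (n : ℕ) : MeasurableSet {ω | inferredNumber ω = n} :=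
  measurable_inferredNumber (MeasurableSet.singleton n)

theorem pureLaw_inter_inferredNumber (hnr : M.NonResonant) (hβ : 0 < M.β) (m n : ℕ)
    (A : Set Trajectory) :
    M.pureLaw m (A ∩ {ω | inferredNumber ω = n}) = if m = n then M.pureLaw n A else 0 := by
  have h := M.ae_inferredNumber_eq hnr hβ m
  split_ifs with hmn
  · subst hmn
    refine measure_congr ?_
    filter_upwards [h] with ω hω
    exact propext ⟨fun h => h.1, fun h => ⟨h, hω⟩⟩
  · rw [measure_eq_zero_iff_ae_notMem]
    filter_upwards [h] with ω hω hmem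
    exact hmn (hω.symm.trans hmem.2)

/-- The event selects one component of the mixture, as the other pure laws give it mass zero. -/
theorem law_inter_inferredNumber (hnr : M.NonResonant) (hβ : 0 < M.β) (ρ : State) (n : ℕ)
    {A : Set Trajectory} (hA : MeasurableSet A) :
    M.law ρ (A ∩ {ω | inferredNumber ω = n}) =
      ENNReal.ofReal (ρ.population n) * M.pureLaw n A := by
  rw [law_eq_sum, Measure.sum_apply _ (hA.inter (measurableSet_inferredNumber n)),
    tsum_eq_single n]
  · simp [M.pureLaw_inter_inferredNumber hnr hβ]
  · intro m hm
    simp [M.pureLaw_inter_inferredNumber hnr hβ, hm]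

theorem law_inferredNumber (hnr : M.NonResonant) (hβ : 0 < M.β) (ρ : State) (n : ℕ) :
    M.law ρ {ω | inferredNumber ω = n} = ENNReal.ofReal (ρ.population n) := by
  simpa using M.law_inter_inferredNumber hnr hβ ρ n MeasurableSet.univ

/-- The density of `ℙ^ρ` with respect to `ℙ^σ`, for a reference state `σ` with positive
populations. -/
theorem law_eq_withDensity (hnr : M.NonResonant) (hβ : 0 < M.β) (ρ σ : State)
    (hσ : ∀ n, 0 < σ.population n) :
    M.law ρ = (M.law σ).withDensity (fun ω => ENNReal.ofReal
      (ρ.population (inferredNumber ω) / σ.population (inferredNumber ω))) := by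
  rw [M.law_eq_sum ρ, M.law_eq_sum σ, withDensity_sum]
  congr 1
  funext n
  -- On each component of the mixture the density is almost surely constant, so it merely rescales
  -- the weight.
  have h : (fun ω => ENNReal.ofReal (ρ.population (inferredNumber ω) /
      σ.population (inferredNumber ω))) =ᵐ[M.pureLaw n]
      fun _ => ENNReal.ofReal (ρ.population n / σ.population n) := by
    filter_upwards [M.ae_inferredNumber_eq hnr hβ n] with ω hω
    rw [hω]
  rw [withDensity_smul_measure, withDensity_congr_ae h, withDensity_const, smul_smul,
    ← ENNReal.ofReal_mul (hσ n).le, mul_div_cancel₀ _ (hσ n).ne']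

end Maser

/-! ### Convergence of the posterior state -/

namespace Maser

variable (M : Maser)

theorem population_rhoInv (hβ : 0 < M.β) (n : ℕ) : (M.rhoInv hβ).population n =
    (∑' n : ℕ, Real.exp (-M.β * M.ε * n))⁻¹ * Real.exp (-M.β * M.ε * n) := by
  rw [State.population, rhoInv, smul_apply, inner_smul_right, M.inner_gibbs hβ, trace_gibbs,
    ← Complex.ofReal_inv, ← Complex.ofReal_mul, Complex.ofReal_re]

theorem population_rhoInv_pos (hβ : 0 < M.β) (n : ℕ) : 0 < (M.rhoInv hβ).population n := by
  rw [population_rhoInv]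
  exact mul_pos (inv_pos.2 (M.partition_pos hβ)) (Real.exp_pos _)

theorem isDiag_rhoInv (hβ : 0 < M.β) :
    IsDiag (M.rhoInv hβ).op (fun n => ((M.rhoInv hβ).population n : ℂ)) := by
  convert (isDiag_numberFn (fun n => ((Real.exp (-M.β * M.ε * n) : ℝ) : ℂ))
    ⟨1, M.norm_gibbs_le hβ⟩).smul (trace (M.gibbs hβ))⁻¹ using 1
  · rfl
  · funext n
    rw [population_rhoInv, trace_gibbs, Complex.ofReal_mul, Complex.ofReal_inv]

/-- The conditional probability of the initial photon number `n` given the first `t` outcomes,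
for the initial state `ρ`. -/
def posterior (ρ : State) (t : ℕ) (ω : Trajectory) (n : ℕ) : ℝ :=
  ρ.population n * M.lik t ω n / ∑' m, ρ.population m * M.lik t ω m

theorem posterior_nonneg (ρ : State) (t : ℕ) (ω : Trajectory) (n : ℕ) :
    0 ≤ M.posterior ρ t ω n :=
  div_nonneg (mul_nonneg (ρ.population_nonneg n) (M.lik_nonneg t ω n))
    (tsum_nonneg fun m => mul_nonneg (ρ.population_nonneg m) (M.lik_nonneg t ω m))

theorem summable_posterior (ρ : State) (t : ℕ) (ω : Trajectory) :
    Summable (M.posterior ρ t ω) :=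
  (M.hasSum_lik ρ t ω).summable.div_const _

/-- Only an inequality: for a word of probability zero the quotients are all `0`. The bound suffices
for the trace-norm estimate. -/
theorem tsum_posterior_le_one (ρ : State) (t : ℕ) (ω : Trajectory) :
    ∑' n, M.posterior ρ t ω n ≤ 1 := by
  simp only [posterior]
  rw [tsum_div_const]
  exact div_self_le_one _

theorem isDiag_Mt (hβ : 0 < M.β) (t : ℕ) (ω : Trajectory) :
    IsDiag (M.Mt hβ t ω) (fun n => (M.posterior (M.rhoInv hβ) t ω n : ℂ)) := by
  have hρ := M.isDiag_rhoInv hβ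
  have hpop := (M.rhoInv hβ).population_nonneg
  have hs := hρ.opSqrt hpop
  have hL := M.isDiag_lik t ω
  have htr : trace (star (M.W t ω) * M.W t ω * (M.rhoInv hβ).op) =
      ((∑' m, (M.rhoInv hβ).population m * M.lik t ω m : ℝ) : ℂ) := by
    simp only [trace, (hL.mul hρ).inner_fock_apply]
    rw [Complex.ofReal_tsum]
    refine tsum_congr fun n => ?_
    push_cast; ring
  rw [Mt, htr, mul_assoc (opSqrt _)]
  convert ((hs.mul hL).mul hs).smul _ using 2 with n
  have h2 : ((√((M.rhoInv hβ).population n) : ℝ) : ℂ) * ((√((M.rhoInv hβ).population n) : ℝ) : ℂ) =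
      ((M.rhoInv hβ).population n : ℂ) := by
    rw [← Complex.ofReal_mul, Real.mul_self_sqrt (hpop n)]
  rw [posterior, Complex.ofReal_div, Complex.ofReal_mul, ← h2]
  ring

theorem traceNorm_Mt_sub_fockProj_le (hβ : 0 < M.β) (t : ℕ) (ω : Trajectory) (k : ℕ) :
    traceNorm (M.Mt hβ t ω - fockProj k) ≤
      ENNReal.ofReal (2 * (1 - M.posterior (M.rhoInv hβ) t ω k)) := by
  have hnn := M.posterior_nonneg (M.rhoInv hβ) t ω
  have hsum := M.summable_posterior (M.rhoInv hβ) t ω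
  have hle := M.tsum_posterior_le_one (M.rhoInv hβ) t ω
  have hk : M.posterior (M.rhoInv hβ) t ω k ≤ 1 :=
    (hsum.le_tsum k fun m _ => hnn m).trans hle
  rw [((M.isDiag_Mt hβ t ω).sub (isDiag_fockProj k)).traceNorm]
  -- Only the `k`-th term differs from the posterior: `1 - p` replaces `p`, a correction of `1 -
  -- 2p`. The sum is at most `1 + (1 - 2p) = 2(1 - p)`.
  have hterm : ∀ n, ‖(M.posterior (M.rhoInv hβ) t ω n : ℂ) - (if n = k then 1 else 0)‖ =
      M.posterior (M.rhoInv hβ) t ω n +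
        if n = k then 1 - 2 * M.posterior (M.rhoInv hβ) t ω k else 0 := by
    intro n
    split_ifs with h
    · rw [h, ← Complex.ofReal_one, ← Complex.ofReal_sub, Complex.norm_real, Real.norm_eq_abs,
        abs_of_nonpos (by linarith)]
      ring
    · rw [sub_zero, Complex.norm_real, Real.norm_of_nonneg (hnn n), add_zero]
  have hS := hsum.hasSum.add (hasSum_ite_eq k (1 - 2 * M.posterior (M.rhoInv hβ) t ω k))
  simp_rw [← hterm] at hS
  rw [← ENNReal.ofReal_tsum_of_nonneg (fun n => norm_nonneg _) hS.summable, hS.tsum_eq]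
  exact ENNReal.ofReal_le_ofReal (by linarith)

/-- Turns Bayes' formula for an unobserved initial number into a conditional probability of an event
of the trajectory space, to which martingale convergence applies. -/
theorem posterior_eq (hnr : M.NonResonant) (hβ : 0 < M.β) (ρ : State) (t : ℕ) (ω : Trajectory)
    (n : ℕ) : M.posterior ρ t ω n =
      (M.law ρ).real ({z | ∀ i < t, z i = ω i} ∩ {z | inferredNumber z = n}) /
        (M.law ρ).real {z | ∀ i < t, z i = ω i} := by
  have hnn : ∀ m, 0 ≤ ρ.population m * M.lik t ω m := fun m =>
    mul_nonneg (ρ.population_nonneg m) (M.lik_nonneg t ω m)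
  rw [measureReal_def, measureReal_def, M.law_inter_inferredNumber hnr hβ ρ n
    (measurableSet_cylinder t ω), pureLaw_cylinder, ← ENNReal.ofReal_mul (ρ.population_nonneg n),
    ENNReal.toReal_ofReal (hnn n), law_cylinder, ← (M.hasSum_lik ρ t ω).tsum_eq,
    ENNReal.toReal_ofReal (tsum_nonneg hnn), posterior]

theorem ae_tendsto_posterior (hnr : M.NonResonant) (hβ : 0 < M.β) (ρ : State) :
    ∀ᵐ ω ∂(M.law ρ), Tendsto (fun t => M.posterior ρ t ω (inferredNumber ω)) atTop (𝓝 1) := by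
  have := M.isProbabilityMeasure_law ρ
  -- Convergence is needed at the random index `inferredNumber ω`, so the exceptional null sets for
  -- all `n` are united first.
  have h := ae_all_iff.2 fun n =>
    tendsto_cylinder_ratio (M.law ρ) (measurableSet_inferredNumber n)
  filter_upwards [h] with ω hω
  have h1 := hω (inferredNumber ω)
  rw [Set.indicator_of_mem (by simp), Pi.one_apply] at h1
  simpa only [M.posterior_eq hnr hβ] using h1

theorem ae_tendsto_traceNorm (hnr : M.NonResonant) (hβ : 0 < M.β) :
    ∀ᵐ ω ∂(M.law (M.rhoInv hβ)), Tendsto (fun t : ℕ =>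
      traceNorm (M.Mt hβ t ω - fockProj (inferredNumber ω))) atTop (𝓝 0) := by
  filter_upwards [M.ae_tendsto_posterior hnr hβ (M.rhoInv hβ)] with ω hω
  have h : Tendsto (fun t => ENNReal.ofReal
      (2 * (1 - M.posterior (M.rhoInv hβ) t ω (inferredNumber ω)))) atTop (𝓝 0) := by
    have := ENNReal.tendsto_ofReal ((hω.const_sub 1).const_mul 2)
    simpa using this
  exact tendsto_of_tendsto_of_tendsto_of_le_of_le tendsto_const_nhds h (fun _ => zero_le)
    fun t => M.traceNorm_Mt_sub_fockProj_le hβ t ω _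

end Maser

end OneAtomMaser

end

theorem proposition3p7 (M : OneAtomMaser.Maser) (hnr : M.NonResonant) (hβ : 0 < M.β) :
    ∃ ninf : OneAtomMaser.Trajectory → ℕ, Measurable ninf ∧
      (∀ᵐ ω ∂(M.law (M.rhoInv hβ)),
        Tendsto (fun t : ℕ => OneAtomMaser.traceNorm
          (M.Mt hβ t ω - OneAtomMaser.fockProj (ninf ω))) atTop (𝓝 0)) ∧
      ∀ ρ : OneAtomMaser.State,
        M.law ρ = (M.law (M.rhoInv hβ)).withDensity (fun ω =>
          ENNReal.ofReal (ρ.population (ninf ω) / (M.rhoInv hβ).population (ninf ω))) ∧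
        ∀ n : ℕ, M.law ρ {ω | ninf ω = n} = ENNReal.ofReal (ρ.population n) :=
  ⟨OneAtomMaser.inferredNumber, OneAtomMaser.measurable_inferredNumber,
    M.ae_tendsto_traceNorm hnr hβ, fun ρ =>
      ⟨M.law_eq_withDensity hnr hβ ρ _ (M.population_rhoInv_pos hβ),
        M.law_inferredNumber hnr hβ ρ⟩⟩
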